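/- Let $m \ge 3$ and let $D \subset \mathbb{R}^m$ be a bounded Lipschitz domain, that is, a nonempty bounded connected open set which near each of its boundary points is, in suitable orthogonal coordinates, the set of points strictly above the graph of a Lipschitz function. Let $$E_m(z) = \frac{1}{(2-m)\,\omega_m\,|z|^{m-2}}, \qquad \omega_m = \frac{2\pi^{m/2}}{\Gamma(m/2)},$$ be the fundamental solution of the Laplace equation, and let $T$ be the Newtonian potential operator $$(Tu)(x) = \int_D E_m(x-y)\,u(y)\,dy .$$ For every $u \in L^2(D)$ this integral converges absolutely for almost every $x \in D$, and $T$ is a bounded linear operator on $L^2(D)$. Let $\mu \in \mathbb{R}\setminus\{0\}$. Then $I - \mu^2 T$ has a bounded inverse $(I-\mu^2T)^{-1} : L^2(D) \to L^2(D)$. Moreover, let $\alpha \in (0,1)$ and suppose that $h \in C^{0,\alpha}(\overline D)$ is a real-valued function that is harmonic in $D$. Then the integral equation $$u - \mu^2\, T u = h \quad \text{in } D$$ has a solution $u \in L^2(D)$, unique up to equality almost everywhere. This solution, $u = (I-\mu^2T)^{-1}h$, (after a change on a null set) satisfies the equation at every point of $D$, belongs to $C^{0,\alpha}(\overline D)$,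 and is $\mu$-panharmonic in $D$, that is, $u \in C^2(D)$ and $\nabla^2 u - \mu^2 u = 0$ in $D$. Thus $(I-\mu^2T)^{-1}$ maps each function in $C^{0,\alpha}(\overline D)$ that is harmonic in $D$ to a function in $C^{0,\alpha}(\overline D)$ that is $\mu$-panharmonic in $D$. -/

import Mathlib

open MeasureTheory
open scoped NNReal Laplacian

noncomputable section

/-- The space `ℝ^m` with its Euclidean structure. -/
abbrev Euc (m : ℕ) : Type := EuclideanSpace ℝ (Fin m)

/-- A bounded Lipschitz domain: a nonempty, bounded, connected open set which, near each of its
boundary points and in suitable orthogonal coordinates, is the part of space strictly above the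
graph of a Lipschitz function. Here `e` is the unit vector of the vertical axis, `inner ℝ e x` is
the vertical coordinate of `x`, and `x - inner ℝ e x • e` is the projection of `x` to the
hyperplane orthogonal to `e`; only the values of `φ` on that hyperplane matter. -/
structure IsBoundedLipschitzDomain {m : ℕ} (D : Set (Euc m)) : Prop where
  isOpen : IsOpen D
  isConnected : IsConnected D
  isBounded : Bornology.IsBounded D
  lipschitz_boundary : ∀ p ∈ frontier D, ∃ (e : Euc m) (r : ℝ) (K : ℝ≥0) (φ : Euc m → ℝ),
    ‖e‖ = 1 ∧ 0 < r ∧ LipschitzWith K φ ∧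
      ∀ x ∈ Metric.ball p r, x ∈ D ↔ φ (x - inner ℝ e x • e) < inner ℝ e x

/-- The area of the unit sphere of `ℝ^m`. -/
def sphereArea (m : ℕ) : ℝ := 2 * Real.pi ^ ((m : ℝ) / 2) / Real.Gamma ((m : ℝ) / 2)

/-- The fundamental solution of the Laplace equation in `ℝ^m`, for `m ≥ 3`. -/
def fundamentalSolution (m : ℕ) (z : Euc m) : ℝ :=
  ((2 - (m : ℝ)) * sphereArea m * ‖z‖ ^ (m - 2))⁻¹

/-- The Newtonian potential `(T u)(x) = ∫_D E_m(x - y) u(y) dy`. -/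
def newtonianPotential {m : ℕ} (D : Set (Euc m)) (u : Euc m → ℝ) (x : Euc m) : ℝ :=
  ∫ y in D, fundamentalSolution m (x - y) * u y

/-- The Hilbert space `L²(D)`. -/
abbrev L2 {m : ℕ} (D : Set (Euc m)) : Type := Lp ℝ 2 (volume.restrict D)

/-- `T` is the bounded operator of `L²(D)` given by the Newtonian potential: for each `f` in
`L²(D)` the integral converges absolutely for almost every `x` in `D`, and its value is
`(T f)(x)`. At most one operator has this property. -/
def IsNewtonianOperator {m : ℕ} (D : Set (Euc m)) (T : L2 D →L[ℝ] L2 D) : Prop :=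
  ∀ f : L2 D, ∀ᵐ x ∂(volume.restrict D),
    IntegrableOn (fun y => fundamentalSolution m (x - y) * f y) D ∧
      T f x = newtonianPotential D f x

/-- `u` is an `L²(D)`-solution of the integral equation `u - lam * T u = h` in `D`. -/
def IsL2Solution {m : ℕ} (D : Set (Euc m)) (lam : ℝ) (h u : Euc m → ℝ) : Prop :=
  MemLp u 2 (volume.restrict D) ∧
    ∀ᵐ x ∂(volume.restrict D), u x - lam * newtonianPotential D u x = h x

/-- `u` belongs to `C^{0,α}(closure D)`; only the values on the closure of `D` matter. -/
def IsHolderOnClosure {m : ℕ} (α : ℝ≥0) (u : Euc m → ℝ) (D : Set (Euc m)) : Prop :=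
  ∃ C : ℝ≥0, HolderOnWith C α u (closure D)

/-- `u` is `μ`-panharmonic in the open set `D`: it is of class `C²` there and satisfies
`∇²u - μ²u = 0`. -/
def IsPanharmonicOn {m : ℕ} (μ : ℝ) (u : Euc m → ℝ) (D : Set (Euc m)) : Prop :=
  ContDiffOn ℝ 2 u D ∧ ∀ x ∈ D, (Δ u) x - μ ^ 2 * u x = 0

end

/-! Write `E(z) = -c |z|^(2-m)` with `c > 0`. Everything rests on two properties of the Newtonian
potential: its sign on `L²` and its smoothing effect.

Sign. By the Gamma integral, `|x-y|^(2-m)` is a positive superposition of the Gaussians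
`exp(-t|x-y|²)`, `t > 0`. Each of these is, up to a positive factor, `∫ exp(-2t|x-w|²)
exp(-2t|y-w|²) dw`. Hence `-⟨Tf, f⟩` is an integral of squares `(∫ g f)²` against a positive weight,
and `⟨Tf, f⟩ ≤ 0` (`exists_newtonianOperator`). The Schur test makes `T` bounded, so `I - μ²T` is
coercive with constant 1 and therefore invertible (`isUnit_one_sub_smul_of_inner_nonpos`).

Smoothing. Since `|z|^(1-m)` is locally integrable, the potential of a bounded density is Lipschitz,
with constant proportional to the supremum of the density. By Arzelà–Ascoli the potential is a
compact operator on the continuous functions on the closure of `D`. An eigenfunction for `μ⁻²` would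
be an `L²` solution of the homogeneous equation, hence zero. The Fredholm alternative thus gives a
continuous solution `u` for continuous `h` (`exists_continuousOn_solution`), and uniqueness in `L²`
identifies it with `(I - μ²T)⁻¹h`.

Regularity is read off from `u = h + μ²Tu`. The second term is Lipschitz, so `u` is as Hölder as
`h`. It is also `C¹`, so `u` is `C¹` in `D`; for such densities `Tu` is `C²` in `D` with `Δ(Tu) = u`
(`newtonianPotential_poisson`), and harmonicity of `h` gives `Δu = μ²u`. The Poisson equation is
proved by a cut-off: away from its density the potential is harmonic, and for a compactly supported
`C¹` density one derivative goes on the density and the identity `∇E * ∇g = g` finishes. -/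

open Set Metric Filter Topology
open scoped ENNReal Convolution

/-! ### Weakly singular kernels: uniform integral estimates. -/

/-- Inverse powers of the norm of order below the dimension are integrable on balls. -/
theorem integrableOn_ball_inv_norm_pow {m j : ℕ} (hj : j < m) (R : ℝ) :
    IntegrableOn (fun z : Euc m => (‖z‖ ^ j)⁻¹) (ball 0 R) := by
  have : Nonempty (Fin m) := ⟨⟨0, by omega⟩⟩
  have : Nontrivial (Euc m) := inferInstance
  rw [integrableOn_fun_norm_addHaar (volume : Measure (Euc m)) (f := fun y : ℝ => (y ^ j)⁻¹)]
  -- The polar weight `r^(m-1)` absorbs `r^(-j)`; since `j ≤ m - 1` the remaining exponent is a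
  -- natural number.
  have h : IntegrableOn (fun y : ℝ => y ^ (m - 1 - j)) (Ioo 0 R) :=
    ((continuous_pow _).integrableOn_Icc (a := 0) (b := R)).mono_set Ioo_subset_Icc_self
  refine h.congr_fun (fun y hy => ?_) measurableSet_Ioo
  have hy : y ≠ 0 := hy.1.ne'
  simp only [finrank_euclideanSpace, Fintype.card_fin, smul_eq_mul]
  rw [show m - 1 = m - 1 - j + j by omega, pow_add]
  field_simp
  congr 1
  omega

/-- Cut the kernel at distance 1. The near part has a finite integral over the whole space,
independent of `x` by translation invariance; the far part is at most 1 on a set of finite measure.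
-/
theorem exists_bound_setIntegral_inv_norm_pow {m j : ℕ} (hj : j < m) {D : Set (Euc m)}
    (hD : Bornology.IsBounded D) :
    ∃ M : ℝ, 0 ≤ M ∧ ∀ x : Euc m, IntegrableOn (fun y => (‖x - y‖ ^ j)⁻¹) D ∧
      ∫ y in D, (‖x - y‖ ^ j)⁻¹ ≤ M := by
  have hfin : volume D < ⊤ := hD.measure_lt_top
  have : IsFiniteMeasure (volume.restrict D) := ⟨by simpa using hfin⟩
  set q : Euc m → ℝ := (ball 0 1).indicator (fun z => (‖z‖ ^ j)⁻¹) with hq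
  have hq0 : ∀ z, 0 ≤ q z := fun z => indicator_nonneg (fun _ _ => by positivity) z
  have hqi : Integrable q :=
    (integrable_indicator_iff measurableSet_ball).2 (integrableOn_ball_inv_norm_pow hj 1)
  have hle : ∀ z : Euc m, (‖z‖ ^ j)⁻¹ ≤ q z + 1 := by
    intro z
    by_cases hz : z ∈ ball (0 : Euc m) 1
    · simp [hq, indicator_of_mem hz]
    · have : 1 ≤ ‖z‖ := by simpa using hz
      have h1 : (‖z‖ ^ j)⁻¹ ≤ 1 := inv_le_one_of_one_le₀ (one_le_pow₀ this)
      linarith [hq0 z]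
  have hqx : ∀ x, Integrable (fun y => q (x - y)) := fun x => hqi.comp_sub_left x
  have hdom : ∀ x, Integrable (fun y => q (x - y) + 1) (volume.restrict D) := fun x =>
    ((hqx x).restrict).add (integrable_const 1)
  have hint : ∀ x : Euc m, IntegrableOn (fun y => (‖x - y‖ ^ j)⁻¹) D := fun x =>
    (hdom x).mono' (by fun_prop) (Eventually.of_forall fun y => by
      rw [Real.norm_of_nonneg (by positivity)]; exact hle _)
  refine ⟨(∫ z, q z) + (volume.restrict D).real univ,
    add_nonneg (integral_nonneg hq0) measureReal_nonneg, fun x => ⟨hint x, ?_⟩⟩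
  calc ∫ y in D, (‖x - y‖ ^ j)⁻¹ ≤ ∫ y in D, (q (x - y) + 1) :=
        integral_mono (hint x) (hdom x) fun y => hle _
    _ = (∫ y in D, q (x - y)) + (volume.restrict D).real univ := by
        rw [integral_add (hqx x).restrict (integrable_const 1)]; simp
    _ ≤ (∫ y, q (x - y)) + (volume.restrict D).real univ := by
        have := setIntegral_le_integral (s := D) (hqx x) (Eventually.of_forall fun y => hq0 _)
        linarith
    _ = _ := by rw [integral_sub_left_eq_self]

/-- For `a ≤ b`, factor out `a⁻ᵏ` and apply Bernoulli's inequality to `(a/b)ᵏ`. The sum on the right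
replaces a mean value argument, in which the segment joining two points could meet the singularity.
When `a = 0` the convention `0⁻¹ = 0` is used. -/
theorem abs_inv_pow_sub_inv_pow_le {k : ℕ} (hk : 1 ≤ k) {a b : ℝ} (ha : 0 ≤ a) (hb : 0 ≤ b) :
    |(a ^ k)⁻¹ - (b ^ k)⁻¹| ≤ k * |a - b| * ((a ^ (k + 1))⁻¹ + (b ^ (k + 1))⁻¹) := by
  wlog hab : a ≤ b generalizing a b
  · rw [abs_sub_comm, abs_sub_comm a b, add_comm (a ^ (k + 1))⁻¹]
    exact this hb ha (le_of_not_ge hab)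
  have hk1 : (1 : ℝ) ≤ k := by exact_mod_cast hk
  rcases ha.eq_or_lt with rfl | ha
  · rcases hb.eq_or_lt with rfl | hb
    · simp
    · rw [zero_pow (by omega), zero_pow (by omega), zero_sub, inv_zero, zero_sub, abs_neg, abs_neg,
        abs_of_pos hb, abs_of_pos (by positivity), zero_add, pow_succ]
      field_simp
      exact hk1
  · have hb : 0 < b := ha.trans_le hab
    have h1 := one_add_mul_le_pow (a := a / b - 1) (by have := div_pos ha hb; linarith) k
    rw [abs_of_nonneg (sub_nonneg.2 (inv_anti₀ (by positivity) (by gcongr))),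
      abs_of_nonpos (sub_nonpos.2 hab)]
    have h2 : (a ^ k)⁻¹ - (b ^ k)⁻¹ = (a ^ k)⁻¹ * (1 - (1 + (a / b - 1)) ^ k) := by
      rw [add_sub_cancel, div_pow]; field_simp
    have h3 : 1 - (1 + (a / b - 1)) ^ k ≤ k * ((b - a) / b) := by
      have : a / b - 1 = -((b - a) / b) := by field_simp; ring
      rw [this] at h1 ⊢
      linarith
    have h4 : (b - a) / b ≤ (b - a) / a := by
      have := sub_nonneg.2 hab
      gcongr
    calc (a ^ k)⁻¹ - (b ^ k)⁻¹ ≤ (a ^ k)⁻¹ * (k * ((b - a) / a)) := by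
          rw [h2]; gcongr; exact h3.trans (by gcongr)
      _ = k * (-(a - b)) * ((a ^ (k + 1))⁻¹ + 0) := by rw [pow_succ]; field_simp; ring
      _ ≤ _ := by
        have := sub_nonneg.2 hab
        gcongr
        · have : -(a - b) = b - a := by ring
          rw [this]; positivity
        · positivity

theorem sphereArea_pos {m : ℕ} (hm : 1 ≤ m) : 0 < sphereArea m := by
  have : (0 : ℝ) < m := by exact_mod_cast hm
  have := Real.Gamma_pos_of_pos (half_pos this)
  have := Real.pi_pos
  unfold sphereArea
  positivity

/-- The positive constant `c` with `E_m(z) = -c |z|^(2-m)`. -/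
noncomputable def newtonConst (m : ℕ) : ℝ := (((m : ℝ) - 2) * sphereArea m)⁻¹

theorem newtonConst_pos {m : ℕ} (hm : 3 ≤ m) : 0 < newtonConst m := by
  have : (3 : ℝ) ≤ m := by exact_mod_cast hm
  have := sphereArea_pos (m := m) (by omega)
  exact inv_pos.2 (mul_pos (by linarith) this)

theorem fundamentalSolution_eq (m : ℕ) (z : Euc m) :
    fundamentalSolution m z = -(newtonConst m * (‖z‖ ^ (m - 2))⁻¹) := by
  unfold fundamentalSolution newtonConst
  rw [mul_inv, ← neg_mul, ← inv_neg]
  congr 2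
  ring

theorem abs_fundamentalSolution {m : ℕ} (hm : 3 ≤ m) (z : Euc m) :
    |fundamentalSolution m z| = newtonConst m * (‖z‖ ^ (m - 2))⁻¹ := by
  have := newtonConst_pos hm
  rw [fundamentalSolution_eq, abs_neg, abs_of_nonneg (by positivity)]

theorem measurable_fundamentalSolution (m : ℕ) : Measurable (fundamentalSolution m) := by
  unfold fundamentalSolution
  fun_prop

theorem fundamentalSolution_neg (m : ℕ) (z : Euc m) :
    fundamentalSolution m (-z) = fundamentalSolution m z := by
  simp [fundamentalSolution]

theorem exists_bound_fundamentalSolution {m : ℕ} (hm : 3 ≤ m) {D : Set (Euc m)}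
    (hD : Bornology.IsBounded D) :
    ∃ M : ℝ, 0 ≤ M ∧ ∀ x : Euc m, IntegrableOn (fun y => fundamentalSolution m (x - y)) D ∧
      ∫ y in D, |fundamentalSolution m (x - y)| ≤ M := by
  obtain ⟨M, hM0, hM⟩ := exists_bound_setIntegral_inv_norm_pow (m := m) (j := m - 2) (by omega) hD
  have hc := newtonConst_pos hm
  refine ⟨newtonConst m * M, by positivity, fun x => ⟨?_, ?_⟩⟩
  · simp_rw [fundamentalSolution_eq]
    exact ((hM x).1.const_mul _).neg
  · simp_rw [abs_fundamentalSolution hm, integral_const_mul]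
    have := (hM x).2
    gcongr

/-- The difference costs one more power of the singularity, and the order `m - 1` is still below the
dimension. -/
theorem exists_lipschitz_bound_fundamentalSolution {m : ℕ} (hm : 3 ≤ m) {D : Set (Euc m)}
    (hD : Bornology.IsBounded D) :
    ∃ M : ℝ, 0 ≤ M ∧ ∀ x x' : Euc m,
      ∫ y in D, |fundamentalSolution m (x - y) - fundamentalSolution m (x' - y)| ≤
        M * ‖x - x'‖ := by
  obtain ⟨M, hM0, hM⟩ := exists_bound_setIntegral_inv_norm_pow (m := m) (j := m - 2 + 1)
    (by omega) hD
  have hc := newtonConst_pos hm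
  refine ⟨newtonConst m * (m - 2 : ℕ) * (2 * M), by positivity, fun x x' => ?_⟩
  have hb : ∀ y, |fundamentalSolution m (x - y) - fundamentalSolution m (x' - y)| ≤
      newtonConst m * (m - 2 : ℕ) * ‖x - x'‖ *
        ((‖x - y‖ ^ (m - 2 + 1))⁻¹ + (‖x' - y‖ ^ (m - 2 + 1))⁻¹) := by
    intro y
    have h1 := abs_inv_pow_sub_inv_pow_le (k := m - 2) (by omega) (norm_nonneg (x - y))
      (norm_nonneg (x' - y))
    have h2 : |‖x - y‖ - ‖x' - y‖| ≤ ‖x - x'‖ := by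
      simpa using abs_norm_sub_norm_le (x - y) (x' - y)
    rw [fundamentalSolution_eq, fundamentalSolution_eq, ← neg_add', abs_neg, ← sub_eq_add_neg,
      ← mul_sub, abs_mul, abs_of_pos hc]
    calc _ ≤ newtonConst m * ((m - 2 : ℕ) * ‖x - x'‖ *
          ((‖x - y‖ ^ (m - 2 + 1))⁻¹ + (‖x' - y‖ ^ (m - 2 + 1))⁻¹)) := by
          gcongr; exact h1.trans (by gcongr)
      _ = _ := by ring
  calc _ ≤ ∫ y in D, newtonConst m * (m - 2 : ℕ) * ‖x - x'‖ *
        ((‖x - y‖ ^ (m - 2 + 1))⁻¹ + (‖x' - y‖ ^ (m - 2 + 1))⁻¹) :=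
        integral_mono_of_nonneg (Eventually.of_forall fun y => abs_nonneg _)
          (((hM x).1.add (hM x').1).const_mul _) (Eventually.of_forall hb)
    _ = newtonConst m * (m - 2 : ℕ) * ‖x - x'‖ *
        ((∫ y in D, (‖x - y‖ ^ (m - 2 + 1))⁻¹) + ∫ y in D, (‖x' - y‖ ^ (m - 2 + 1))⁻¹) := by
        rw [integral_const_mul, integral_add (hM x).1 (hM x').1]
    _ ≤ newtonConst m * (m - 2 : ℕ) * ‖x - x'‖ * (M + M) := by
        have := (hM x).2
        have := (hM x').2
        gcongr
    _ = _ := by ring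

/-! ### Boundedness on `L²` of symmetric kernels. -/

section SchurTest

variable {X : Type*} [MeasurableSpace X] {ν : Measure X} [IsFiniteMeasure ν]
  {K : X → X → ℝ} {M : ℝ≥0∞}

/-- Tonelli turns the row integrals into column integrals, which by symmetry obey the same bound. -/
theorem lintegral_enorm_kernel_mul_le (hK : Measurable (Function.uncurry K))
    (hsymm : ∀ x y, K x y = K y x) (hM : ∀ x, ∫⁻ y, ‖K x y‖ₑ ∂ν ≤ M)
    {w : X → ℝ≥0∞} (hw : AEMeasurable w ν) :
    ∫⁻ x, ∫⁻ y, ‖K x y‖ₑ * w y ∂ν ∂ν ≤ M * ∫⁻ y, w y ∂ν := by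
  have hKe : Measurable (fun p : X × X => ‖K p.1 p.2‖ₑ) := hK.enorm
  rw [lintegral_lintegral_swap (hKe.aemeasurable.mul hw.comp_snd), ← lintegral_const_mul'' _ hw]
  refine lintegral_mono fun y => ?_
  rw [lintegral_mul_const _ (by exact hKe.comp (measurable_id.prodMk measurable_const))]
  gcongr
  simpa only [hsymm y] using hM y

/-- The Schur test: a symmetric kernel with uniformly bounded row integrals is bounded on `L²`. -/
theorem lintegral_sq_kernel_le (hK : Measurable (Function.uncurry K))
    (hsymm : ∀ x y, K x y = K y x) (hM : ∀ x, ∫⁻ y, ‖K x y‖ₑ ∂ν ≤ M)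
    {f : X → ℝ} (hf : AEStronglyMeasurable f ν) :
    ∫⁻ x, (∫⁻ y, ‖K x y‖ₑ * ‖f y‖ₑ ∂ν) ^ 2 ∂ν ≤ M ^ 2 * ∫⁻ y, ‖f y‖ₑ ^ 2 ∂ν := by
  have hKx : ∀ x, Measurable (fun y => ‖K x y‖ₑ) := fun x =>
    (hK.comp (measurable_const.prodMk measurable_id)).enorm
  have hpt : ∀ x, (∫⁻ y, ‖K x y‖ₑ * ‖f y‖ₑ ∂ν) ^ 2 ≤
      M * ∫⁻ y, ‖K x y‖ₑ * ‖f y‖ₑ ^ 2 ∂ν := by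
    intro x
    have hfm : AEMeasurable (fun y => ‖f y‖ₑ) ν := hf.enorm
    -- Cauchy–Schwarz for the splitting `|K||f| = |K|^(1/2) · |K|^(1/2)|f|`.
    have h := ENNReal.lintegral_mul_le_Lp_mul_Lq ν (p := 2) (q := 2)
      (Real.holderConjugate_iff.2 ⟨by norm_num, by norm_num⟩)
      (f := fun y => ‖K x y‖ₑ ^ (1 / 2 : ℝ)) (g := fun y => ‖K x y‖ₑ ^ (1 / 2 : ℝ) * ‖f y‖ₑ)
      ((hKx x).pow_const _).aemeasurable (((hKx x).pow_const _).aemeasurable.mul hfm)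
    have e1 : ∀ a : ℝ≥0∞, a ^ (1 / 2 : ℝ) * a ^ (1 / 2 : ℝ) = a := fun a => by
      rw [← ENNReal.rpow_add_of_nonneg _ _ (by norm_num) (by norm_num)]; norm_num
    have e2 : ∀ a : ℝ≥0∞, (a ^ (1 / 2 : ℝ)) ^ (2 : ℝ) = a := fun a => by
      rw [← ENNReal.rpow_mul]; norm_num
    simp only [Pi.mul_apply, ← mul_assoc, e1, ENNReal.mul_rpow_of_nonneg _ _ zero_le_two, e2] at h
    calc (∫⁻ y, ‖K x y‖ₑ * ‖f y‖ₑ ∂ν) ^ 2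
        ≤ ((∫⁻ y, ‖K x y‖ₑ ∂ν) ^ (1 / 2 : ℝ) *
            (∫⁻ y, ‖K x y‖ₑ * ‖f y‖ₑ ^ (2 : ℝ) ∂ν) ^ (1 / 2 : ℝ)) ^ 2 := by gcongr
      _ = (∫⁻ y, ‖K x y‖ₑ ∂ν) * ∫⁻ y, ‖K x y‖ₑ * ‖f y‖ₑ ^ 2 ∂ν := by
          rw [mul_pow]
          simp only [← ENNReal.rpow_two, e2]
      _ ≤ _ := by gcongr; exact hM x
  have hf2 : AEMeasurable (fun y => ‖f y‖ₑ ^ 2) ν := hf.enorm.pow_const _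
  calc _ ≤ ∫⁻ x, M * ∫⁻ y, ‖K x y‖ₑ * ‖f y‖ₑ ^ 2 ∂ν ∂ν := lintegral_mono hpt
    _ = M * ∫⁻ x, ∫⁻ y, ‖K x y‖ₑ * ‖f y‖ₑ ^ 2 ∂ν ∂ν := by
      rw [lintegral_const_mul'']
      exact AEMeasurable.lintegral_prod_right'
        (f := fun p : X × X => ‖K p.1 p.2‖ₑ * ‖f p.2‖ₑ ^ 2)
        (hK.enorm.aemeasurable.mul hf2.comp_snd)
    _ ≤ M * (M * ∫⁻ y, ‖f y‖ₑ ^ 2 ∂ν) := by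
      gcongr; exact lintegral_enorm_kernel_mul_le hK hsymm hM hf2
    _ = _ := by ring

theorem integrable_prod_kernel_mul (hK : Measurable (Function.uncurry K))
    (hsymm : ∀ x y, K x y = K y x) (hM : ∀ x, ∫⁻ y, ‖K x y‖ₑ ∂ν ≤ M) (hMtop : M ≠ ⊤)
    {f : X → ℝ} (hf : Integrable f ν) :
    Integrable (fun p : X × X => K p.1 p.2 * f p.2) (ν.prod ν) := by
  have hmeas : AEStronglyMeasurable (fun p : X × X => K p.1 p.2 * f p.2) (ν.prod ν) :=
    hK.aestronglyMeasurable.mul hf.1.comp_snd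
  refine ⟨hmeas, ?_⟩
  rw [hasFiniteIntegral_iff_enorm, lintegral_prod _ hmeas.enorm]
  simp_rw [enorm_mul]
  refine (lintegral_enorm_kernel_mul_le hK hsymm hM hf.1.enorm).trans_lt ?_
  exact ENNReal.mul_lt_top hMtop.lt_top hf.2

/-- Dominate `|f x f y|` by `f x ² + f y ²`; each square reduces to the case of a single `L¹`
factor. -/
theorem integrable_prod_kernel_mul_mul (hK : Measurable (Function.uncurry K))
    (hsymm : ∀ x y, K x y = K y x) (hM : ∀ x, ∫⁻ y, ‖K x y‖ₑ ∂ν ≤ M) (hMtop : M ≠ ⊤)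
    {f : X → ℝ} (hf : MemLp f 2 ν) :
    Integrable (fun p : X × X => K p.1 p.2 * (f p.1 * f p.2)) (ν.prod ν) := by
  have h1 : Integrable (fun p : X × X => K p.1 p.2 * f p.2 ^ 2) (ν.prod ν) :=
    integrable_prod_kernel_mul hK hsymm hM hMtop hf.integrable_sq
  have h2 : Integrable (fun p : X × X => K p.1 p.2 * f p.1 ^ 2) (ν.prod ν) := by
    refine h1.swap.congr (Eventually.of_forall fun p => ?_)
    simp [hsymm p.1 p.2]
  refine (h1.abs.add h2.abs).mono'
    (hK.aestronglyMeasurable.mul (hf.1.comp_fst.mul hf.1.comp_snd))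
    (Eventually.of_forall fun p => ?_)
  simp only [Pi.add_apply, Real.norm_eq_abs, abs_mul, abs_pow, sq_abs]
  have := abs_nonneg (K p.1 p.2)
  have h3 : |f p.1| * |f p.2| ≤ f p.2 ^ 2 + f p.1 ^ 2 := by
    rw [← sq_abs (f p.1), ← sq_abs (f p.2)]
    nlinarith [sq_nonneg (|f p.1| - |f p.2|), sq_nonneg (|f p.1|), sq_nonneg (|f p.2|)]
  rw [← mul_add]
  gcongr

theorem memLp_integral_kernel (hK : Measurable (Function.uncurry K))
    (hsymm : ∀ x y, K x y = K y x) (hM : ∀ x, ∫⁻ y, ‖K x y‖ₑ ∂ν ≤ M) (hMtop : M ≠ ⊤)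
    {f : X → ℝ} (hf : MemLp f 2 ν) :
    MemLp (fun x => ∫ y, K x y * f y ∂ν) 2 ν ∧
      eLpNorm (fun x => ∫ y, K x y * f y ∂ν) 2 ν ≤ M * eLpNorm f 2 ν := by
  have hm : AEStronglyMeasurable (fun x => ∫ y, K x y * f y ∂ν) ν :=
    (integrable_prod_kernel_mul hK hsymm hM hMtop
      (hf.integrable one_le_two)).integral_prod_left.1
  have hle : eLpNorm (fun x => ∫ y, K x y * f y ∂ν) 2 ν ≤ M * eLpNorm f 2 ν := by
    rw [eLpNorm_eq_lintegral_rpow_enorm_toReal two_ne_zero ENNReal.ofNat_ne_top,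
      eLpNorm_eq_lintegral_rpow_enorm_toReal two_ne_zero ENNReal.ofNat_ne_top]
    simp only [ENNReal.toReal_ofNat, ENNReal.rpow_two]
    calc _ ≤ (M ^ 2 * ∫⁻ y, ‖f y‖ₑ ^ 2 ∂ν) ^ (1 / 2 : ℝ) := by
          gcongr
          refine le_trans (lintegral_mono fun x => ?_) (lintegral_sq_kernel_le hK hsymm hM hf.1)
          gcongr
          refine (enorm_integral_le_lintegral_enorm _).trans_eq ?_
          simp_rw [enorm_mul]
      _ = _ := by
          rw [ENNReal.mul_rpow_of_nonneg _ _ (by norm_num), ← ENNReal.rpow_two, ← ENNReal.rpow_mul]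
          norm_num
  exact ⟨⟨hm, hle.trans_lt (ENNReal.mul_lt_top hMtop.lt_top hf.2)⟩, hle⟩

/-- The bounded operator of `L²` with a given symmetric kernel. -/
theorem exists_kernel_operator (hK : Measurable (Function.uncurry K))
    (hsymm : ∀ x y, K x y = K y x) (hM : ∀ x, ∫⁻ y, ‖K x y‖ₑ ∂ν ≤ M) (hMtop : M ≠ ⊤) :
    ∃ T : Lp ℝ 2 ν →L[ℝ] Lp ℝ 2 ν, ∀ f : Lp ℝ 2 ν, ∀ᵐ x ∂ν,
      Integrable (fun y => K x y * f y) ν ∧ T f x = ∫ y, K x y * f y ∂ν := by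
  have hmem : ∀ f : Lp ℝ 2 ν, MemLp f 2 ν := fun f => Lp.memLp f
  have hint : ∀ f : Lp ℝ 2 ν, ∀ᵐ x ∂ν, Integrable (fun y => K x y * f y) ν := fun f =>
    (integrable_prod_kernel_mul hK hsymm hM hMtop ((hmem f).integrable one_le_two)).prod_right_ae
  have hT := fun f : Lp ℝ 2 ν => memLp_integral_kernel hK hsymm hM hMtop (hmem f)
  let T₀ : Lp ℝ 2 ν →ₗ[ℝ] Lp ℝ 2 ν :=
    { toFun := fun f => (hT f).1.toLp _
      map_add' := fun f g => by
        rw [← MemLp.toLp_add]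
        refine MemLp.toLp_congr _ _ ?_
        filter_upwards [hint f, hint g] with x hf hg
        rw [Pi.add_apply, ← integral_add hf hg]
        refine integral_congr_ae ?_
        filter_upwards [Lp.coeFn_add f g] with y hy
        rw [hy, Pi.add_apply, mul_add]
      map_smul' := fun c f => by
        rw [RingHom.id_apply, ← MemLp.toLp_const_smul]
        refine MemLp.toLp_congr _ _ (Eventually.of_forall fun x => ?_)
        rw [Pi.smul_apply, smul_eq_mul, ← integral_const_mul]
        refine integral_congr_ae ?_
        filter_upwards [Lp.coeFn_smul c f] with y hy
        rw [hy, Pi.smul_apply, smul_eq_mul]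
        ring }
  refine ⟨T₀.mkContinuous M.toReal fun f => ?_, fun f => ?_⟩
  · change ‖(hT f).1.toLp _‖ ≤ _
    rw [Lp.norm_toLp, Lp.norm_def, ← ENNReal.toReal_mul]
    exact ENNReal.toReal_mono (ENNReal.mul_ne_top hMtop (hmem f).2.ne) (hT f).2
  · filter_upwards [hint f, (hT f).1.coeFn_toLp] with x hx hx'
    exact ⟨hx, hx'⟩

end SchurTest

/-! ### Negativity of the Newtonian kernel by Gaussian superposition. -/

/-- A kernel which is a superposition of positive rank one kernels is positive semidefinite. -/
theorem integral_kernel_mul_mul_nonneg {X Z : Type*} [MeasurableSpace X] [MeasurableSpace Z]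
    {ν : Measure X} {lam : Measure Z} [SFinite ν] [SFinite lam] {K : X → X → ℝ}
    {g : X → Z → ℝ} {W : Z → ℝ} (hg : Measurable (Function.uncurry g)) (hg0 : ∀ x z, 0 ≤ g x z)
    (hW : Measurable W) (hW0 : ∀ z, 0 ≤ W z) (hK0 : ∀ x y, 0 ≤ K x y)
    (hKg : ∀ᵐ p ∂ν.prod ν,
      ∫⁻ z, ENNReal.ofReal (W z * (g p.1 z * g p.2 z)) ∂lam = ENNReal.ofReal (K p.1 p.2))
    {f : X → ℝ} (hf : AEStronglyMeasurable f ν)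
    (hint : Integrable (fun p : X × X => K p.1 p.2 * (f p.1 * f p.2)) (ν.prod ν)) :
    0 ≤ ∫ p, K p.1 p.2 * (f p.1 * f p.2) ∂ν.prod ν := by
  have hG : Measurable (fun q : (X × X) × Z => W q.2 * (g q.1.1 q.2 * g q.1.2 q.2)) := by
    have h1 : Measurable (fun q : (X × X) × Z => g q.1.1 q.2) :=
      hg.comp ((measurable_fst.comp measurable_fst).prodMk measurable_snd)
    have h2 : Measurable (fun q : (X × X) × Z => g q.1.2 q.2) :=
      hg.comp ((measurable_snd.comp measurable_fst).prodMk measurable_snd)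
    exact (hW.comp measurable_snd).mul (h1.mul h2)
  have hG0 : ∀ (p : X × X) z, 0 ≤ W z * (g p.1 z * g p.2 z) := fun p z =>
    mul_nonneg (hW0 _) (mul_nonneg (hg0 _ _) (hg0 _ _))
  have hff : AEStronglyMeasurable (fun p : X × X => f p.1 * f p.2) (ν.prod ν) :=
    hf.comp_fst.mul hf.comp_snd
  have hF : AEStronglyMeasurable
      (fun q : (X × X) × Z => W q.2 * (g q.1.1 q.2 * g q.1.2 q.2) * (f q.1.1 * f q.1.2))
      ((ν.prod ν).prod lam) := hG.aestronglyMeasurable.mul hff.comp_fst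
  have hFi : Integrable
      (fun q : (X × X) × Z => W q.2 * (g q.1.1 q.2 * g q.1.2 q.2) * (f q.1.1 * f q.1.2))
      ((ν.prod ν).prod lam) := by
    refine ⟨hF, ?_⟩
    rw [hasFiniteIntegral_iff_enorm, lintegral_prod _ hF.enorm]
    refine lt_of_eq_of_lt (lintegral_congr_ae ?_) hint.2
    filter_upwards [hKg] with p hp
    simp only [enorm_mul (_ * (_ * _)) (_ * _)]
    rw [lintegral_mul_const', enorm_mul (K _ _), Real.enorm_of_nonneg (hK0 _ _), ← hp]
    · congr 1
      refine lintegral_congr fun z => ?_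
      rw [Real.enorm_of_nonneg (hG0 p z)]
    · exact enorm_ne_top
  have h1 : ∫ p, K p.1 p.2 * (f p.1 * f p.2) ∂ν.prod ν =
      ∫ p : X × X, ∫ z, W z * (g p.1 z * g p.2 z) * (f p.1 * f p.2) ∂lam ∂ν.prod ν := by
    refine integral_congr_ae ?_
    filter_upwards [hKg] with p hp
    rw [integral_mul_const, integral_eq_lintegral_of_nonneg_ae (Eventually.of_forall (hG0 p))
      (by exact (hG.comp (measurable_const.prodMk measurable_id)).aestronglyMeasurable), hp,
      ENNReal.toReal_ofReal (hK0 _ _)]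
  rw [h1, integral_integral_swap hFi]
  refine integral_nonneg fun z => ?_
  -- For fixed `z` the integrand separates, so the double integral is a perfect square.
  have h2 : ∫ p : X × X, W z * (g p.1 z * g p.2 z) * (f p.1 * f p.2) ∂ν.prod ν =
      W z * ((∫ x, g x z * f x ∂ν) * ∫ x, g x z * f x ∂ν) := by
    rw [← integral_prod_mul, ← integral_const_mul]
    congr 1
    ext p
    ring
  rw [h2]
  exact mul_nonneg (hW0 z) (mul_self_nonneg _)

/-- By the parallelogram law the exponents add up to one Gaussian in `w` centred at the midpoint of
`x` and `y`, times a factor free of `w`. -/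
theorem lintegral_gaussian_mul_gaussian {m : ℕ} (x y : Euc m) {t : ℝ} (ht : 0 < t) :
    ∫⁻ w : Euc m, ENNReal.ofReal
      (Real.exp (-(2 * t) * ‖x - w‖ ^ 2) * Real.exp (-(2 * t) * ‖y - w‖ ^ 2)) =
      ENNReal.ofReal (Real.exp (-(‖x - y‖ ^ 2 * t)) * (Real.pi / (4 * t)) ^ ((m : ℝ) / 2)) := by
  have hpt : ∀ w : Euc m,
      Real.exp (-(2 * t) * ‖x - w‖ ^ 2) * Real.exp (-(2 * t) * ‖y - w‖ ^ 2) =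
      Real.exp (-(‖x - y‖ ^ 2 * t)) *
        Real.exp (-(4 * t) * ‖w - (2⁻¹ : ℝ) • (x + y)‖ ^ 2) := by
    intro w
    rw [← Real.exp_add, ← Real.exp_add]
    congr 1
    have h := parallelogram_law_with_norm ℝ (x - w) (y - w)
    have h1 : x - w + (y - w) = (-2 : ℝ) • (w - (2⁻¹ : ℝ) • (x + y)) := by module
    have h2 : x - w - (y - w) = x - y := by abel
    rw [h1, h2, norm_smul, Real.norm_eq_abs, abs_neg, abs_two] at h
    linear_combination t * h
  have h4 : 0 < 4 * t := by positivity
  have hval := GaussianFourier.integral_rexp_neg_mul_sq_norm (V := Euc m) h4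
  have hpos : 0 < (Real.pi / (4 * t)) ^ ((m : ℝ) / 2) :=
    Real.rpow_pos_of_pos (div_pos Real.pi_pos h4) _
  rw [finrank_euclideanSpace, Fintype.card_fin] at hval
  -- A non-integrable function has Bochner integral 0, so a nonzero value proves integrability.
  have hi : Integrable (fun w : Euc m => Real.exp (-(4 * t) * ‖w‖ ^ 2)) :=
    .of_integral_ne_zero (by rw [hval]; exact hpos.ne')
  have hi' := (hi.comp_sub_right ((2⁻¹ : ℝ) • (x + y))).const_mul (Real.exp (-(‖x - y‖ ^ 2 * t)))
  simp_rw [hpt]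
  rw [← ofReal_integral_eq_lintegral_ofReal hi' (Eventually.of_forall fun w => by positivity),
    integral_const_mul, integral_sub_right_eq_self (fun w : Euc m => Real.exp (-(4 * t) * ‖w‖ ^ 2)),
    hval]

/-- Inverse powers of the distance are superpositions of products of Gaussians. -/
theorem lintegral_gaussian_superposition {m : ℕ} {a : ℝ} (ha : 0 < a) {x y : Euc m} (hxy : x ≠ y) :
    ∫⁻ z : ℝ × Euc m, ENNReal.ofReal
      ((|z.1| ^ (a - 1) * ((Real.pi / (4 * |z.1|)) ^ ((m : ℝ) / 2))⁻¹) *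
        (Real.exp (-(2 * z.1) * ‖x - z.2‖ ^ 2) * Real.exp (-(2 * z.1) * ‖y - z.2‖ ^ 2)))
      ∂((volume.restrict (Ioi 0)).prod volume) =
      ENNReal.ofReal ((1 / ‖x - y‖ ^ 2) ^ a * Real.Gamma a) := by
  have hr : 0 < ‖x - y‖ ^ 2 := by have := norm_pos_iff.2 (sub_ne_zero.2 hxy); positivity
  rw [lintegral_prod _ (by fun_prop)]
  have hval := Real.integral_rpow_mul_exp_neg_mul_Ioi ha hr
  have hpos : 0 < (1 / ‖x - y‖ ^ 2) ^ a * Real.Gamma a :=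
    mul_pos (Real.rpow_pos_of_pos (by positivity) _) (Real.Gamma_pos_of_pos ha)
  have hi : IntegrableOn (fun t : ℝ => t ^ (a - 1) * Real.exp (-(‖x - y‖ ^ 2 * t))) (Ioi 0) :=
    .of_integral_ne_zero (by rw [hval]; exact hpos.ne')
  rw [← hval, ofReal_integral_eq_lintegral_ofReal hi]
  · refine setLIntegral_congr_fun measurableSet_Ioi fun t ht => ?_
    have ht : 0 < t := ht
    have hp : 0 < (Real.pi / (4 * t)) ^ ((m : ℝ) / 2) :=
      Real.rpow_pos_of_pos (div_pos Real.pi_pos (by positivity)) _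
    simp only [abs_of_pos ht]
    have hnn : 0 ≤ t ^ (a - 1) * ((Real.pi / (4 * t)) ^ ((m : ℝ) / 2))⁻¹ := by positivity
    simp_rw [ENNReal.ofReal_mul hnn]
    rw [lintegral_const_mul' _ _ ENNReal.ofReal_ne_top, lintegral_gaussian_mul_gaussian x y ht,
      ← ENNReal.ofReal_mul hnn]
    congr 1
    field_simp
  · filter_upwards [self_mem_ae_restrict measurableSet_Ioi] with t ht
    have ht : 0 < t := ht
    simp only [Pi.zero_apply]
    positivity

/-- The superposition formula fails on the diagonal, where its integral is infinite while
`fundamentalSolution` takes the value 0. -/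
theorem ae_prod_fst_ne_snd {m : ℕ} (ν : Measure (Euc m)) [SFinite ν] [NullSingletonClass ν] :
    ∀ᵐ p ∂ν.prod ν, p.1 ≠ p.2 := by
  have hms : MeasurableSet {p : Euc m × Euc m | p.1 ≠ p.2} :=
    (measurableSet_eq_fun measurable_fst measurable_snd).compl
  rw [Measure.ae_prod_iff_ae_ae hms]
  refine Eventually.of_forall fun x => ?_
  have : ∀ᵐ y ∂ν, y ∉ ({x} : Set (Euc m)) := measure_eq_zero_iff_ae_notMem.1 (measure_singleton x)
  filter_upwards [this] with y hy h
  exact hy (by simp_all)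

/-- The kernel `-E_m(x - y)` is positive semidefinite. -/
theorem integral_fundamentalSolution_mul_mul_nonpos {m : ℕ} (hm : 3 ≤ m) (ν : Measure (Euc m))
    [SFinite ν] [NullSingletonClass ν] {f : Euc m → ℝ} (hf : AEStronglyMeasurable f ν)
    (hint : Integrable (fun p : Euc m × Euc m =>
      fundamentalSolution m (p.1 - p.2) * (f p.1 * f p.2)) (ν.prod ν)) :
    ∫ p, fundamentalSolution m (p.1 - p.2) * (f p.1 * f p.2) ∂ν.prod ν ≤ 0 := by
  have hm3 : (3 : ℝ) ≤ m := by exact_mod_cast hm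
  have ha : 0 < ((m : ℝ) - 2) / 2 := by linarith
  have hΓ := Real.Gamma_pos_of_pos ha
  have hc := newtonConst_pos hm
  -- Dividing by the Gamma value normalizes the integral in `t`. In the weight `W` below, the
  -- inverse power of `π/(4|t|)` cancels the Gaussian integral in `w`, and `|t|` makes `W`
  -- nonnegative for every real `t`.
  set C : ℝ := newtonConst m / Real.Gamma (((m : ℝ) - 2) / 2) with hC
  have hC0 : 0 < C := div_pos hc hΓ
  have key := integral_kernel_mul_mul_nonneg (ν := ν)
    (lam := (volume.restrict (Ioi (0 : ℝ))).prod (volume : Measure (Euc m)))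
    (K := fun x y => -fundamentalSolution m (x - y))
    (g := fun x z => Real.exp (-(2 * z.1) * ‖x - z.2‖ ^ 2))
    (W := fun z => C * (|z.1| ^ (((m : ℝ) - 2) / 2 - 1) *
      ((Real.pi / (4 * |z.1|)) ^ ((m : ℝ) / 2))⁻¹))
    (by unfold Function.uncurry; fun_prop) (fun x z => (Real.exp_pos _).le) (by fun_prop)
    (fun z => by have := Real.pi_pos; positivity)
    (fun x y => by rw [fundamentalSolution_eq]; simp only [neg_neg]; positivity)
    ?_ hf (by simpa using hint.neg)
  · simpa [integral_neg] using key
  · filter_upwards [ae_prod_fst_ne_snd ν] with p hp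
    simp_rw [mul_assoc C, ENNReal.ofReal_mul hC0.le]
    rw [lintegral_const_mul' _ _ ENNReal.ofReal_ne_top, lintegral_gaussian_superposition ha hp,
      ← ENNReal.ofReal_mul hC0.le]
    congr 1
    have hr := norm_pos_iff.2 (sub_ne_zero.2 hp)
    have hpow : (1 / ‖p.1 - p.2‖ ^ 2) ^ (((m : ℝ) - 2) / 2) = (‖p.1 - p.2‖ ^ (m - 2))⁻¹ := by
      rw [one_div, Real.inv_rpow (by positivity), ← Real.rpow_natCast, ← Real.rpow_mul hr.le,
        ← Real.rpow_natCast]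
      congr 2
      push_cast [Nat.cast_sub (show 2 ≤ m by omega)]
      ring
    rw [hpow, fundamentalSolution_eq, hC, neg_neg]
    field_simp

/-! ### The operator on `L²(D)` and its resolvent. -/

/-- The Newtonian potential operator of `L²(D)`, together with its negativity. -/
theorem exists_newtonianOperator {m : ℕ} (hm : 3 ≤ m) {D : Set (Euc m)}
    (hD : Bornology.IsBounded D) :
    ∃ T : L2 D →L[ℝ] L2 D, IsNewtonianOperator D T ∧ ∀ f : L2 D, inner ℝ (T f) f ≤ 0 := by
  have : IsFiniteMeasure (volume.restrict D) := ⟨by simpa using hD.measure_lt_top⟩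
  have : Nonempty (Fin m) := ⟨⟨0, by omega⟩⟩
  obtain ⟨M, hM0, hM⟩ := exists_bound_fundamentalSolution hm hD
  have hK : Measurable (Function.uncurry fun x y : Euc m => fundamentalSolution m (x - y)) :=
    (measurable_fundamentalSolution m).comp (measurable_fst.sub measurable_snd)
  have hsymm : ∀ x y : Euc m, fundamentalSolution m (x - y) = fundamentalSolution m (y - x) :=
    fun x y => by rw [← fundamentalSolution_neg, neg_sub]
  have hM' : ∀ x : Euc m, ∫⁻ y in D, ‖fundamentalSolution m (x - y)‖ₑ ≤ ENNReal.ofReal M := by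
    intro x
    rw [← ofReal_integral_norm_eq_lintegral_enorm (hM x).1]
    exact ENNReal.ofReal_le_ofReal (hM x).2
  obtain ⟨T, hT⟩ := exists_kernel_operator hK hsymm hM' ENNReal.ofReal_ne_top
  refine ⟨T, hT, fun f => ?_⟩
  have hint := integrable_prod_kernel_mul_mul hK hsymm hM' ENNReal.ofReal_ne_top (Lp.memLp f)
  have h := integral_fundamentalSolution_mul_mul_nonpos hm (volume.restrict D)
    (Lp.aestronglyMeasurable f) hint
  rw [integral_prod _ hint] at h
  refine le_of_eq_of_le ?_ h
  rw [L2.inner_def]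
  refine integral_congr_ae ?_
  filter_upwards [hT f] with x hx
  rw [hx.2]
  simp only [RCLike.inner_apply, conj_trivial]
  rw [← integral_const_mul]
  congr 1
  ext y
  ring

/-- The form `⟨(1 - cT)f, f⟩ = ‖f‖² - c⟨Tf, f⟩` is at least `‖f‖²`, so the operator is coercive. -/
theorem isUnit_one_sub_smul_of_inner_nonpos {H : Type*} [NormedAddCommGroup H]
    [InnerProductSpace ℝ H] [CompleteSpace H] {T : H →L[ℝ] H} (hT : ∀ f, inner ℝ (T f) f ≤ 0)
    {c : ℝ} (hc : 0 ≤ c) : IsUnit (1 - c • T) := by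
  refine ContinuousLinearMap.isUnit_of_forall_le_norm_inner_map _ one_pos fun f => ?_
  have h : inner ℝ ((1 - c • T) f) f = ‖f‖ ^ 2 - c * inner ℝ (T f) f := by
    simp [inner_sub_left, inner_smul_left]
  rw [h]
  refine le_trans ?_ (le_abs_self _)
  have := mul_nonpos_of_nonneg_of_nonpos hc (hT f)
  simp only [NNReal.coe_one, mul_one]
  linarith

/-! ### Potentials of bounded densities: supremum and Lipschitz bounds. -/

section BoundedDensities

variable {m : ℕ} {D : Set (Euc m)} {f : Euc m → ℝ} {B : ℝ}

theorem integrableOn_fundamentalSolution_mul (hm : 3 ≤ m) (hD : Bornology.IsBounded D)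
    (hf : AEStronglyMeasurable f (volume.restrict D)) (hB : ∀ x, |f x| ≤ B) (x : Euc m) :
    IntegrableOn (fun y => fundamentalSolution m (x - y) * f y) D := by
  obtain ⟨M, -, hM⟩ := exists_bound_fundamentalSolution hm hD
  exact (hM x).1.mul_bdd hf (Eventually.of_forall hB)

theorem exists_bound_newtonianPotential (hm : 3 ≤ m) (hD : Bornology.IsBounded D) :
    ∃ M : ℝ, 0 ≤ M ∧ ∀ (f : Euc m → ℝ) (B : ℝ), (∀ x, |f x| ≤ B) →
      ∀ x, |newtonianPotential D f x| ≤ M * B := by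
  obtain ⟨M, hM0, hM⟩ := exists_bound_fundamentalSolution hm hD
  refine ⟨M, hM0, fun f B hB x => ?_⟩
  have hB0 : 0 ≤ B := (abs_nonneg _).trans (hB x)
  calc |newtonianPotential D f x|
      = ‖∫ y in D, fundamentalSolution m (x - y) * f y‖ := rfl
    _ ≤ ∫ y in D, |fundamentalSolution m (x - y)| * B := by
        refine norm_integral_le_of_norm_le ((hM x).1.abs.mul_const B)
          (Eventually.of_forall fun y => ?_)
        rw [norm_mul]
        gcongr
        · rfl
        · exact hB y
    _ = (∫ y in D, |fundamentalSolution m (x - y)|) * B := integral_mul_const _ _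
    _ ≤ M * B := by have := (hM x).2; gcongr

theorem exists_lipschitz_bound_newtonianPotential (hm : 3 ≤ m) (hD : Bornology.IsBounded D) :
    ∃ M : ℝ, 0 ≤ M ∧ ∀ (f : Euc m → ℝ) (B : ℝ), AEStronglyMeasurable f (volume.restrict D) →
      (∀ x, |f x| ≤ B) → ∀ x x', |newtonianPotential D f x - newtonianPotential D f x'| ≤
        M * B * ‖x - x'‖ := by
  obtain ⟨M, hM0, hM⟩ := exists_lipschitz_bound_fundamentalSolution hm hD
  obtain ⟨N, -, hint⟩ := exists_bound_fundamentalSolution hm hD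
  refine ⟨M, hM0, fun f B hf hB x x' => ?_⟩
  have hB0 : 0 ≤ B := (abs_nonneg _).trans (hB x)
  unfold newtonianPotential
  rw [← Real.norm_eq_abs, ← integral_sub (integrableOn_fundamentalSolution_mul hm hD hf hB x)
    (integrableOn_fundamentalSolution_mul hm hD hf hB x')]
  calc _ ≤ ∫ y in D, |fundamentalSolution m (x - y) - fundamentalSolution m (x' - y)| * B := by
        refine norm_integral_le_of_norm_le
          (((hint x).1.sub (hint x').1).abs.mul_const B) (Eventually.of_forall fun y => ?_)
        rw [← sub_mul, norm_mul]
        gcongr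
        · rfl
        · exact hB y
    _ = (∫ y in D, |fundamentalSolution m (x - y) - fundamentalSolution m (x' - y)|) * B :=
        integral_mul_const _ _
    _ ≤ M * ‖x - x'‖ * B := by have := hM x x'; gcongr
    _ = _ := by ring

end BoundedDensities

/-! ### Uniqueness of `L²` solutions. -/

section SolutionsInL2

variable {m : ℕ} {D : Set (Euc m)} {T : L2 D →L[ℝ] L2 D} {c : ℝ} {h v : Euc m → ℝ}

theorem IsNewtonianOperator.one_sub_smul_toLp (hT : IsNewtonianOperator D T)
    (hh : MemLp h 2 (volume.restrict D)) (hv : IsL2Solution D c h v) :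
    (1 - c • T) (hv.1.toLp v) = hh.toLp h := by
  refine Lp.ext ?_
  have e : (1 - c • T) (hv.1.toLp v) = hv.1.toLp v - c • T (hv.1.toLp v) := by simp
  rw [e]
  filter_upwards [Lp.coeFn_sub (hv.1.toLp v) (c • T (hv.1.toLp v)),
    Lp.coeFn_smul c (T (hv.1.toLp v)), hT (hv.1.toLp v), hv.2, hv.1.coeFn_toLp,
    hh.coeFn_toLp] with x h1 h2 h3 h4 h5 h6
  rw [h1, Pi.sub_apply, h2, Pi.smul_apply, h3.2, h5, h6, smul_eq_mul, ← h4]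
  congr 2
  refine integral_congr_ae ?_
  filter_upwards [hv.1.coeFn_toLp] with y hy
  rw [hy]

theorem IsL2Solution.ae_eq {R : L2 D →L[ℝ] L2 D} (hT : IsNewtonianOperator D T)
    (hR : R * (1 - c • T) = 1) (hh : MemLp h 2 (volume.restrict D))
    (hv : IsL2Solution D c h v) : R (hh.toLp h) =ᵐ[volume.restrict D] v := by
  rw [← hT.one_sub_smul_toLp hh hv, ← mul_apply_eq_comp, hR]
  exact hv.1.coeFn_toLp

end SolutionsInL2

theorem memLp_of_continuousOn_closure {m : ℕ} {D : Set (Euc m)} (hD : Bornology.IsBounded D)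
    {h : Euc m → ℝ} (hh : ContinuousOn h (closure D)) : MemLp h 2 (volume.restrict D) := by
  have hc : IsCompact (closure D) := hD.isCompact_closure
  have : IsFiniteMeasure (volume.restrict (closure D)) := ⟨by simpa using hc.measure_lt_top⟩
  obtain ⟨B, hB⟩ := hc.exists_bound_of_continuousOn hh
  have : MemLp h 2 (volume.restrict (closure D)) :=
    MemLp.of_bound (hh.aestronglyMeasurable isClosed_closure.measurableSet) B
      ((ae_restrict_iff' isClosed_closure.measurableSet).2 (Eventually.of_forall hB))
  exact this.mono_measure (Measure.restrict_mono subset_closure le_rfl)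

/-! ### The Fredholm alternative on the continuous functions on `closure D`. -/

section ContinuousSolutions

open scoped BoundedContinuousFunction

variable {m : ℕ} {D : Set (Euc m)}

/-- Extension by zero of a function on the closure of `D`. -/
noncomputable def extendZero (f : closure D →ᵇ ℝ) : Euc m → ℝ :=
  Function.extend Subtype.val f 0

theorem extendZero_apply (f : closure D →ᵇ ℝ) (x : closure D) : extendZero f x = f x :=
  Subtype.val_injective.extend_apply _ _ _

theorem extendZero_of_notMem (f : closure D →ᵇ ℝ) {x : Euc m} (hx : x ∉ closure D) :
    extendZero f x = 0 :=
  Function.extend_apply' _ _ _ (by rintro ⟨y, rfl⟩; exact hx y.2)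

theorem measurable_extendZero (f : closure D →ᵇ ℝ) : Measurable (extendZero f) :=
  (MeasurableEmbedding.subtype_coe isClosed_closure.measurableSet).measurable_extend
    f.continuous.measurable measurable_zero

theorem abs_extendZero_le (f : closure D →ᵇ ℝ) (x : Euc m) : |extendZero f x| ≤ ‖f‖ := by
  by_cases hx : x ∈ closure D
  · have := extendZero_apply f ⟨x, hx⟩
    simp only at this
    rw [this]
    exact f.norm_coe_le_norm _
  · rw [extendZero_of_notMem f hx, abs_zero]
    exact norm_nonneg f

theorem continuousOn_extendZero (f : closure D →ᵇ ℝ) : ContinuousOn (extendZero f) (closure D) := by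
  rw [continuousOn_iff_continuous_domRestrict]
  convert f.continuous using 1
  ext x
  exact extendZero_apply f x

theorem extendZero_add (f g : closure D →ᵇ ℝ) (x : Euc m) :
    extendZero (f + g) x = extendZero f x + extendZero g x := by
  by_cases hx : x ∈ closure D
  · simpa using (extendZero_apply (f + g) ⟨x, hx⟩).trans
      (congr_arg₂ (· + ·) (extendZero_apply f ⟨x, hx⟩) (extendZero_apply g ⟨x, hx⟩)).symm
  · simp [extendZero_of_notMem _ hx]

theorem extendZero_smul (c : ℝ) (f : closure D →ᵇ ℝ) (x : Euc m) :
    extendZero (c • f) x = c * extendZero f x := by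
  by_cases hx : x ∈ closure D
  · simpa using (extendZero_apply (c • f) ⟨x, hx⟩).trans
      (congr_arg (c * ·) (extendZero_apply f ⟨x, hx⟩)).symm
  · simp [extendZero_of_notMem _ hx]

/-- The Newtonian potential is a compact operator on the continuous functions on `closure D`. -/
theorem exists_compact_newtonianPotential (hm : 3 ≤ m) (hD : Bornology.IsBounded D) :
    ∃ S : (closure D →ᵇ ℝ) →L[ℝ] (closure D →ᵇ ℝ), IsCompactOperator S ∧
      ∀ f x, S f x = newtonianPotential D (extendZero f) x := by
  have hcs : CompactSpace (closure D) := isCompact_iff_compactSpace.1 hD.isCompact_closure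
  obtain ⟨M, hM0, hM⟩ := exists_bound_newtonianPotential hm hD
  obtain ⟨L, hL0, hL⟩ := exists_lipschitz_bound_newtonianPotential hm hD
  have hMf := fun f : closure D →ᵇ ℝ => hM (extendZero f) ‖f‖ (abs_extendZero_le f)
  have hLf := fun f : closure D →ᵇ ℝ => hL (extendZero f) ‖f‖
    (measurable_extendZero f).aestronglyMeasurable (abs_extendZero_le f)
  have hlip : ∀ f : closure D →ᵇ ℝ,
      LipschitzWith (L * ‖f‖).toNNReal (newtonianPotential D (extendZero f)) := fun f =>
    LipschitzWith.of_dist_le_mul fun x y => by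
      rw [Real.coe_toNNReal _ (by positivity), dist_eq_norm, dist_eq_norm]
      exact hLf f x y
  have hint := fun (f : closure D →ᵇ ℝ) (x : Euc m) => integrableOn_fundamentalSolution_mul hm hD
    (measurable_extendZero f).aestronglyMeasurable (abs_extendZero_le f) x
  let S₀ : (closure D →ᵇ ℝ) →ₗ[ℝ] (closure D →ᵇ ℝ) :=
    { toFun := fun f => BoundedContinuousFunction.mkOfCompact
        ⟨fun x => newtonianPotential D (extendZero f) x,
          (hlip f).continuous.comp continuous_subtype_val⟩
      map_add' := fun f g => by
        ext x
        simp only [BoundedContinuousFunction.mkOfCompact_apply, ContinuousMap.coe_mk,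
          BoundedContinuousFunction.coe_add, Pi.add_apply, newtonianPotential, extendZero_add,
          mul_add]
        exact integral_add (hint f x) (hint g x)
      map_smul' := fun c f => by
        ext x
        simp only [BoundedContinuousFunction.mkOfCompact_apply, ContinuousMap.coe_mk,
          BoundedContinuousFunction.coe_smul, newtonianPotential, extendZero_smul,
          RingHom.id_apply, smul_eq_mul, ← integral_const_mul]
        congr 1
        ext y
        ring }
  let S := S₀.mkContinuous M fun f => by
    rw [BoundedContinuousFunction.norm_le (by positivity)]
    exact fun x => hMf f x
  have hS : ∀ f x, S f x = newtonianPotential D (extendZero f) x := fun f x => rfl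
  refine ⟨S, ⟨closure (S '' ball 0 1), ?_, ?_⟩, hS⟩
  -- The images of the unit ball are bounded by `M` and share the Lipschitz constant `L`.
  · refine BoundedContinuousFunction.arzela_ascoli (closedBall 0 M) (isCompact_closedBall _ _) _
      ?_ ?_
    · rintro _ x ⟨f, hf, rfl⟩
      rw [mem_closedBall_zero_iff, hS]
      rw [mem_ball_zero_iff] at hf
      exact (hMf f x).trans (mul_le_of_le_one_right hM0 hf.le)
    · refine (LipschitzWith.uniformEquicontinuous _ L.toNNReal ?_).equicontinuous
      rintro ⟨_, f, hf, rfl⟩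
      rw [mem_ball_zero_iff] at hf
      refine LipschitzWith.of_dist_le_mul fun x y => ?_
      rw [Real.coe_toNNReal _ hL0, dist_eq_norm, Subtype.dist_eq, dist_eq_norm]
      simp only [hS]
      refine (hLf f x y).trans ?_
      gcongr
      exact mul_le_of_le_one_right hL0 hf.le
  · exact mem_of_superset (ball_mem_nhds _ one_pos)
      fun f hf => subset_closure (mem_image_of_mem _ hf)

/-- Continuous data have continuous solutions, provided the equation is uniquely solvable
in `L²(D)`. -/
theorem exists_continuousOn_solution (hm : 3 ≤ m) (ho : IsOpen D) (hD : Bornology.IsBounded D)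
    {T R : L2 D →L[ℝ] L2 D} (hT : IsNewtonianOperator D T) {c : ℝ} (hc : c ≠ 0)
    (hR : R * (1 - c • T) = 1) {h : Euc m → ℝ} (hh : ContinuousOn h (closure D)) :
    ∃ f : Euc m → ℝ, Measurable f ∧ (∃ B, ∀ x, |f x| ≤ B) ∧ ContinuousOn f (closure D) ∧
      ∀ x ∈ closure D, f x - c * newtonianPotential D f x = h x := by
  have hcs : CompactSpace (closure D) := isCompact_iff_compactSpace.1 hD.isCompact_closure
  obtain ⟨S, hS, hSf⟩ := exists_compact_newtonianPotential hm hD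
  have hres : c⁻¹ ∈ resolventSet ℝ S := by
    -- An eigenfunction for `c⁻¹` solves the homogeneous equation, so it vanishes a.e. in `D` by
    -- `L²` uniqueness, and then on the closure by continuity.
    refine (hS.hasEigenvalue_or_mem_resolventSet (inv_ne_zero hc)).resolve_left fun he => ?_
    obtain ⟨f, hf⟩ := he.exists_hasEigenvector
    have hfS : S f = c⁻¹ • f := hf.apply_eq_smul
    have hsol : IsL2Solution D c 0 (extendZero f) := by
      refine ⟨memLp_of_continuousOn_closure hD (continuousOn_extendZero f), ?_⟩
      filter_upwards [self_mem_ae_restrict ho.measurableSet] with x hx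
      have h1 := congr_arg (fun g : closure D →ᵇ ℝ => g ⟨x, subset_closure hx⟩) hfS
      have h2 := extendZero_apply f ⟨x, subset_closure hx⟩
      simp only [hSf, BoundedContinuousFunction.coe_smul, smul_eq_mul] at h1 h2
      rw [h1, h2, mul_inv_cancel_left₀ hc, sub_self, Pi.zero_apply]
    have h0 : extendZero f =ᵐ[volume.restrict D] 0 := by
      have h1 := hsol.ae_eq hT hR MemLp.zero
      rw [MemLp.toLp_zero, map_zero] at h1
      exact h1.symm.trans (Lp.coeFn_zero _ _ _)
    have h1 : EqOn (extendZero f) 0 D :=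
      Measure.eqOn_open_of_ae_eq h0 ho ((continuousOn_extendZero f).mono subset_closure)
        continuousOn_const
    have h2 : EqOn (extendZero f) 0 (closure D) :=
      h1.of_subset_closure (continuousOn_extendZero f) continuousOn_const subset_closure
        subset_rfl
    refine hf.2 (BoundedContinuousFunction.ext fun x => ?_)
    rw [← extendZero_apply, h2 x.2]
    rfl
  have hu : IsUnit (algebraMap ℝ ((closure D →ᵇ ℝ) →L[ℝ] (closure D →ᵇ ℝ)) c⁻¹ - S) := hres
  obtain ⟨f, hf⟩ := (ContinuousLinearMap.isUnit_iff_bijective.1 hu).2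
    (c⁻¹ • BoundedContinuousFunction.mkOfCompact ⟨(closure D).domRestrict h,
      continuousOn_iff_continuous_domRestrict.1 hh⟩)
  refine ⟨extendZero f, measurable_extendZero f, ⟨_, abs_extendZero_le f⟩,
    continuousOn_extendZero f, fun x hx => ?_⟩
  have h1 := congr_arg (fun g : closure D →ᵇ ℝ => g ⟨x, hx⟩) hf
  have h2 := extendZero_apply f ⟨x, hx⟩
  simp only [Algebra.algebraMap_eq_smul_one] at h1 h2
  simp [hSf] at h1
  rw [h2]
  field_simp at h1
  exact h1

end ContinuousSolutions

/-! ### Regularization of the fundamental solution. -/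

section RegularizedKernel

variable {m : ℕ} {a : ℝ}

/-- The regularization `-c (|z|² + a)^((2-m)/2)` of the fundamental solution. -/
noncomputable def regKernel (m : ℕ) (a : ℝ) (z : Euc m) : ℝ :=
  -(newtonConst m * (‖z‖ ^ 2 + a) ^ (-(((m : ℝ) - 2) / 2)))

/-- The gradient of `regKernel`. -/
noncomputable def regGradient (m : ℕ) (a : ℝ) (z : Euc m) : Euc m :=
  ((sphereArea m)⁻¹ * (‖z‖ ^ 2 + a) ^ (-((m : ℝ) / 2))) • z

theorem hasFDerivAt_norm_sq_add (a : ℝ) (z : Euc m) :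
    HasFDerivAt (fun z : Euc m => ‖z‖ ^ 2 + a) (2 • innerSL ℝ z) z :=
  (hasStrictFDerivAt_norm_sq z).hasFDerivAt.add_const a

theorem hasFDerivAt_regKernel (hm : 3 ≤ m) {z : Euc m} (h : 0 < ‖z‖ ^ 2 + a) :
    HasFDerivAt (regKernel m a) (innerSL ℝ (regGradient m a z)) z := by
  have h1 := (((hasFDerivAt_norm_sq_add a z).rpow_const (p := -(((m : ℝ) - 2) / 2))
    (Or.inl h.ne')).const_mul (newtonConst m)).neg
  refine h1.congr_fderiv ?_
  have h3 : (3 : ℝ) ≤ m := by exact_mod_cast hm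
  have hω := sphereArea_pos (m := m) (by omega)
  have h2 : (m : ℝ) - 2 ≠ 0 := by linarith
  ext w
  simp only [regGradient, newtonConst, neg_apply,
    smul_apply, innerSL_apply_apply, inner_smul_left, smul_eq_mul,
    nsmul_eq_mul, conj_trivial]
  rw [show -(((m : ℝ) - 2) / 2) - 1 = -((m : ℝ) / 2) by ring]
  field_simp
  push_cast
  ring

theorem regKernel_zero (hm : 3 ≤ m) : regKernel m 0 = fundamentalSolution m := by
  have h3 : (3 : ℝ) ≤ m := by exact_mod_cast hm
  ext z
  rw [fundamentalSolution_eq, regKernel, add_zero, Real.rpow_neg (by positivity),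
    ← Real.rpow_natCast (‖z‖) 2, ← Real.rpow_mul (norm_nonneg z),
    ← Real.rpow_natCast _ (m - 2), Nat.cast_sub (by omega)]
  congr 4
  push_cast
  ring

theorem regGradient_zero_eq (z : Euc m) :
    regGradient m 0 z = ((sphereArea m)⁻¹ * (‖z‖ ^ m)⁻¹) • z := by
  rw [regGradient, add_zero, Real.rpow_neg (by positivity), ← Real.rpow_natCast (‖z‖) 2,
    ← Real.rpow_mul (norm_nonneg z), ← Real.rpow_natCast _ m]
  congr 4
  push_cast
  ring

theorem continuous_regKernel (ha : 0 < a) : Continuous (regKernel m a) := by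
  unfold regKernel
  refine (continuous_const.mul (Continuous.rpow_const (by fun_prop) fun z => ?_)).neg
  exact Or.inl (by positivity)

theorem continuous_regGradient (ha : 0 < a) : Continuous (regGradient m a) := by
  unfold regGradient
  refine (continuous_const.mul (Continuous.rpow_const (by fun_prop) fun z => ?_)).smul
    continuous_id
  exact Or.inl (by positivity)

theorem measurable_regGradient (a : ℝ) : Measurable (regGradient m a) := by
  unfold regGradient
  fun_prop

/-- This supplies a dominating function uniform in `a`. The origin is excluded because
`fundamentalSolution` is 0 there. -/
theorem abs_regKernel_le (hm : 3 ≤ m) (ha : 0 ≤ a) {z : Euc m} (hz : z ≠ 0) :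
    |regKernel m a z| ≤ |fundamentalSolution m z| := by
  have h3 : (3 : ℝ) ≤ m := by exact_mod_cast hm
  have hc := newtonConst_pos hm
  have hz' : 0 < ‖z‖ := norm_pos_iff.2 hz
  rw [← regKernel_zero hm]
  unfold regKernel
  rw [abs_neg, abs_neg, abs_of_nonneg (by positivity), abs_of_nonneg (by positivity)]
  gcongr ?_ * ?_
  exact Real.rpow_le_rpow_of_nonpos (by positivity) (by linarith) (by linarith)

theorem abs_regKernel_le_const (hm : 3 ≤ m) (ha : 0 < a) (z : Euc m) :
    |regKernel m a z| ≤ newtonConst m * a ^ (-(((m : ℝ) - 2) / 2)) := by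
  have h3 : (3 : ℝ) ≤ m := by exact_mod_cast hm
  have hc := newtonConst_pos hm
  unfold regKernel
  rw [abs_neg, abs_of_nonneg (by positivity)]
  gcongr ?_ * ?_
  exact Real.rpow_le_rpow_of_nonpos ha (by nlinarith [sq_nonneg ‖z‖]) (by linarith)

theorem norm_regGradient (hm : 3 ≤ m) (ha : 0 ≤ a) (z : Euc m) :
    ‖regGradient m a z‖ = (sphereArea m)⁻¹ * (‖z‖ ^ 2 + a) ^ (-((m : ℝ) / 2)) * ‖z‖ := by
  have hω := sphereArea_pos (m := m) (by omega)
  rw [regGradient, norm_smul, Real.norm_of_nonneg (by positivity)]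

theorem norm_regGradient_le (hm : 3 ≤ m) (ha : 0 ≤ a) (z : Euc m) :
    ‖regGradient m a z‖ ≤ (sphereArea m)⁻¹ * (‖z‖ ^ (m - 1))⁻¹ := by
  have hω := sphereArea_pos (m := m) (by omega)
  rcases eq_or_ne z 0 with rfl | hz
  · simp only [regGradient, smul_zero, norm_zero]
    positivity
  have hz' : 0 < ‖z‖ := norm_pos_iff.2 hz
  calc ‖regGradient m a z‖ ≤ ‖regGradient m 0 z‖ := by
        rw [norm_regGradient hm ha, norm_regGradient hm le_rfl]
        gcongr ?_ * ?_ * ?_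
        exact Real.rpow_le_rpow_of_nonpos (by positivity) (by linarith)
          (by have : (0 : ℝ) ≤ m := by positivity
              linarith)
    _ = _ := by
        rw [regGradient_zero_eq, norm_smul, Real.norm_of_nonneg (by positivity)]
        obtain ⟨k, rfl⟩ : ∃ k, m = k + 1 := ⟨m - 1, by omega⟩
        rw [Nat.add_sub_cancel, pow_succ]
        field_simp

/-- Since `‖z‖ ≤ (‖z‖² + a)^(1/2)`, only a negative power of `‖z‖² + a ≥ a` remains. For fixed `a`
this permits differentiation under the integral. -/
theorem norm_regGradient_le_const (hm : 3 ≤ m) (ha : 0 < a) (z : Euc m) :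
    ‖regGradient m a z‖ ≤ (sphereArea m)⁻¹ * a ^ (-(((m : ℝ) - 1) / 2)) := by
  have h3 : (3 : ℝ) ≤ m := by exact_mod_cast hm
  have hω := sphereArea_pos (m := m) (by omega)
  have hs : 0 < ‖z‖ ^ 2 + a := by positivity
  have h1 : ‖z‖ ≤ (‖z‖ ^ 2 + a) ^ (1 / 2 : ℝ) := by
    rw [← Real.sqrt_eq_rpow]
    exact Real.le_sqrt_of_sq_le (by linarith)
  rw [norm_regGradient hm ha.le, mul_assoc]
  gcongr ?_ * ?_
  calc (‖z‖ ^ 2 + a) ^ (-((m : ℝ) / 2)) * ‖z‖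
      ≤ (‖z‖ ^ 2 + a) ^ (-((m : ℝ) / 2)) * (‖z‖ ^ 2 + a) ^ (1 / 2 : ℝ) := by gcongr
    _ = (‖z‖ ^ 2 + a) ^ (-(((m : ℝ) - 1) / 2)) := by
        rw [← Real.rpow_add hs]; congr 1; ring
    _ ≤ _ := Real.rpow_le_rpow_of_nonpos ha (by nlinarith [sq_nonneg ‖z‖]) (by linarith)

theorem tendsto_regKernel {u : ℕ → ℝ} (hu : Tendsto u atTop (𝓝 0)) {z : Euc m} (hz : z ≠ 0) :
    Tendsto (fun n => regKernel m (u n) z) atTop (𝓝 (regKernel m 0 z)) := by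
  have hz' : 0 < ‖z‖ := norm_pos_iff.2 hz
  unfold regKernel
  refine ((Tendsto.rpow_const (hu.const_add _) (Or.inl ?_)).const_mul _).neg
  positivity

theorem tendsto_regGradient {u : ℕ → ℝ} (hu : Tendsto u atTop (𝓝 0)) {z : Euc m} (hz : z ≠ 0) :
    Tendsto (fun n => regGradient m (u n) z) atTop (𝓝 (regGradient m 0 z)) := by
  have hz' : 0 < ‖z‖ := norm_pos_iff.2 hz
  unfold regGradient
  refine ((Tendsto.rpow_const (hu.const_add _) (Or.inl ?_)).const_mul _).smul_const _
  positivity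

end RegularizedKernel

/-! ### First derivatives of the potential. -/

section FirstDerivatives

variable {m : ℕ} {D : Set (Euc m)} {f : Euc m → ℝ} {B : ℝ}

theorem hasFDerivAt_integral_regKernel (hm : 3 ≤ m) (hD : Bornology.IsBounded D)
    (hf : AEStronglyMeasurable f (volume.restrict D)) (hB : ∀ x, |f x| ≤ B) {a : ℝ} (ha : 0 < a)
    (x : Euc m) :
    HasFDerivAt (fun x => ∫ y in D, regKernel m a (x - y) * f y)
      (innerSL ℝ (∫ y in D, f y • regGradient m a (x - y))) x := by
  have : IsFiniteMeasure (volume.restrict D) := ⟨by simpa using hD.measure_lt_top⟩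
  have hB0 : 0 ≤ B := (abs_nonneg _).trans (hB x)
  have hK := fun x : Euc m => ((continuous_regKernel (m := m) ha).comp
    (continuous_const.sub continuous_id : Continuous fun y : Euc m => x - y)).aestronglyMeasurable
    (μ := volume.restrict D)
  have hG := fun x : Euc m => ((continuous_regGradient (m := m) ha).comp
    (continuous_const.sub continuous_id : Continuous fun y : Euc m => x - y)).aestronglyMeasurable
    (μ := volume.restrict D)
  have hbd : ∀ x y : Euc m, ‖f y • regGradient m a (x - y)‖ ≤
      B * ((sphereArea m)⁻¹ * a ^ (-(((m : ℝ) - 1) / 2))) := fun x y => by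
    rw [norm_smul]
    gcongr
    · exact hB y
    · exact norm_regGradient_le_const hm ha _
  have hint : ∀ x, Integrable (fun y => f y • regGradient m a (x - y)) (volume.restrict D) :=
    fun x => Integrable.of_bound (hf.smul (hG x)) _ (Eventually.of_forall (hbd x))
  have key := hasFDerivAt_integral_of_dominated_of_fderiv_le (𝕜 := ℝ) (μ := volume.restrict D)
    (F := fun x y => regKernel m a (x - y) * f y)
    (F' := fun x y => innerSL ℝ (f y • regGradient m a (x - y))) (x₀ := x) (s := univ)
    (bound := fun _ => B * ((sphereArea m)⁻¹ * a ^ (-(((m : ℝ) - 1) / 2))))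
    univ_mem (Eventually.of_forall fun x => (hK x).mul hf) ?_ ?_ ?_ (integrable_const _) ?_
  · rwa [ContinuousLinearMap.integral_comp_comm _ (hint x)] at key
  · refine Integrable.of_bound ((hK x).mul hf)
      (newtonConst m * a ^ (-(((m : ℝ) - 2) / 2)) * B) (Eventually.of_forall fun y => ?_)
    have h1 := newtonConst_pos hm
    rw [norm_mul]
    gcongr
    · exact abs_regKernel_le_const hm ha _
    · exact hB y
  · exact (innerSL ℝ).continuous.comp_aestronglyMeasurable (hf.smul (hG x))
  · refine Eventually.of_forall fun y x' _ => ?_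
    rw [innerSL_apply_norm]
    exact hbd x' y
  · refine Eventually.of_forall fun y x' _ => ?_
    have h1 := ((hasFDerivAt_regKernel hm (a := a) (z := x' - y) (by positivity)).comp x'
      ((hasFDerivAt_id x').sub_const y)).mul_const (f y)
    refine h1.congr_fderiv ?_
    ext w
    simp

theorem continuous_integral_regGradient (hm : 3 ≤ m) (hD : Bornology.IsBounded D)
    (hf : AEStronglyMeasurable f (volume.restrict D)) (hB : ∀ x, |f x| ≤ B) {a : ℝ} (ha : 0 < a) :
    Continuous (fun x => ∫ y in D, f y • regGradient m a (x - y)) := by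
  have : IsFiniteMeasure (volume.restrict D) := ⟨by simpa using hD.measure_lt_top⟩
  have hB0 : 0 ≤ B := (abs_nonneg _).trans (hB 0)
  refine continuous_of_dominated (bound := fun _ =>
    B * ((sphereArea m)⁻¹ * a ^ (-(((m : ℝ) - 1) / 2)))) (fun x => ?_) (fun x => ?_)
    (integrable_const _) ?_
  · exact hf.smul ((continuous_regGradient (m := m) ha).comp
      (continuous_const.sub continuous_id)).aestronglyMeasurable
  · refine Eventually.of_forall fun y => ?_
    rw [norm_smul]
    gcongr
    · exact hB y
    · exact norm_regGradient_le_const hm ha _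
  · refine Eventually.of_forall fun y => ?_
    have := continuous_regGradient (m := m) ha
    fun_prop

/-- All translates `x - D` with `x` in the ball of radius `ρ` lie in one ball, so the bound is
uniform in `x`. -/
theorem setIntegral_comp_sub_le {g : Euc m → ℝ} (hg0 : ∀ z, 0 ≤ g z) {ρ R : ℝ}
    (hDm : MeasurableSet D) (hDR : D ⊆ ball 0 R) (hg : IntegrableOn g (ball 0 (ρ + R)))
    {x : Euc m} (hx : x ∈ ball (0 : Euc m) ρ) :
    ∫ y in D, g (x - y) ≤ ∫ z in ball 0 (ρ + R), g z := by
  have hi : Integrable ((ball 0 (ρ + R)).indicator g) :=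
    (integrable_indicator_iff measurableSet_ball).2 hg
  calc ∫ y in D, g (x - y) = ∫ y in D, (ball 0 (ρ + R)).indicator g (x - y) := by
        refine setIntegral_congr_fun hDm fun y hy => ?_
        have : x - y ∈ ball (0 : Euc m) (ρ + R) := by
          have h1 := hDR hy
          rw [mem_ball_zero_iff] at *
          exact (norm_sub_le _ _).trans_lt (add_lt_add hx h1)
        simp only [indicator_of_mem this]
    _ ≤ ∫ y, (ball 0 (ρ + R)).indicator g (x - y) :=
        setIntegral_le_integral (hi.comp_sub_left x)
          (Eventually.of_forall fun y => indicator_nonneg (fun z _ => hg0 z) _)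
    _ = ∫ z in ball 0 (ρ + R), g z := by
        rw [integral_sub_left_eq_self, integral_indicator measurableSet_ball]

theorem integrableOn_smul_regGradient (hm : 3 ≤ m) (hD : Bornology.IsBounded D)
    (hf : AEStronglyMeasurable f (volume.restrict D)) (hB : ∀ x, |f x| ≤ B) {a : ℝ} (ha : 0 ≤ a)
    (x : Euc m) : IntegrableOn (fun y => f y • regGradient m a (x - y)) D := by
  obtain ⟨M, -, hM⟩ := exists_bound_setIntegral_inv_norm_pow (m := m) (j := m - 1) (by omega) hD
  have hB0 : 0 ≤ B := (abs_nonneg _).trans (hB 0)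
  refine (((hM x).1.const_mul (sphereArea m)⁻¹).const_mul B).mono'
    (hf.smul ((measurable_regGradient a).comp (measurable_const.sub measurable_id)).aestronglyMeasurable)
    (Eventually.of_forall fun y => ?_)
  rw [norm_smul]
  gcongr
  · exact hB y
  · exact norm_regGradient_le hm ha _

/-- The error is at most `B` times the `L¹` norm, on a fixed ball, of the difference of the
gradients. This bound is free of `x` and tends to 0 by dominated convergence, with a multiple of
`|z|^(1-m)` as majorant. -/
theorem tendstoUniformlyOn_integral_regGradient (hm : 3 ≤ m) (hDm : MeasurableSet D)
    (hD : Bornology.IsBounded D) (hf : AEStronglyMeasurable f (volume.restrict D))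
    (hB : ∀ x, |f x| ≤ B) {u : ℕ → ℝ} (hu0 : ∀ n, 0 < u n) (hu : Tendsto u atTop (𝓝 0)) (ρ : ℝ) :
    TendstoUniformlyOn (fun n x => ∫ y in D, f y • regGradient m (u n) (x - y))
      (fun x => ∫ y in D, f y • regGradient m 0 (x - y)) atTop (ball 0 ρ) := by
  have : Nonempty (Fin m) := ⟨⟨0, by omega⟩⟩
  obtain ⟨R, hR⟩ := hD.subset_ball (0 : Euc m)
  have hB0 : 0 ≤ B := (abs_nonneg _).trans (hB 0)
  have hbi : IntegrableOn (fun z : Euc m => (sphereArea m)⁻¹ * (‖z‖ ^ (m - 1))⁻¹)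
    (ball 0 (ρ + R)) := (integrableOn_ball_inv_norm_pow (by omega) _).const_mul _
  have hgi : ∀ a, 0 ≤ a → IntegrableOn (regGradient m a) (ball 0 (ρ + R)) := fun a ha =>
    hbi.mono' (measurable_regGradient a).aestronglyMeasurable
      (Eventually.of_forall fun z => norm_regGradient_le hm ha z)
  have hlim : Tendsto (fun n => ∫ z in ball (0 : Euc m) (ρ + R),
      ‖regGradient m (u n) z - regGradient m 0 z‖) atTop (𝓝 0) := by
    have h0 : ∫ z in ball (0 : Euc m) (ρ + R), (0 : ℝ) = 0 := by simp
    refine Eq.subst (motive := fun c => Tendsto _ atTop (𝓝 c)) h0 ?_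
    refine tendsto_integral_of_dominated_convergence _
      (fun n => ((hgi _ (hu0 n).le).sub (hgi 0 le_rfl)).1.norm) (hbi.add hbi)
      (fun n => Eventually.of_forall fun z => ?_) ?_
    · rw [norm_norm]
      exact (norm_sub_le _ _).trans
        (add_le_add (norm_regGradient_le hm (hu0 n).le z) (norm_regGradient_le hm le_rfl z))
    · have : ∀ᵐ z : Euc m ∂(volume.restrict (ball (0 : Euc m) (ρ + R))), z ∉ ({0} : Set (Euc m)) :=
        measure_eq_zero_iff_ae_notMem.1 (measure_singleton 0)
      filter_upwards [this] with z hz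
      have := ((tendsto_regGradient hu (by simpa using hz)).sub_const (regGradient m 0 z)).norm
      simpa using this
  rw [Metric.tendstoUniformlyOn_iff]
  intro ε hε
  have hlim' := hlim.const_mul B
  rw [mul_zero] at hlim'
  filter_upwards [hlim'.eventually_lt_const hε] with n hn x hx
  refine lt_of_le_of_lt ?_ hn
  rw [dist_comm, dist_eq_norm,
    ← integral_sub (integrableOn_smul_regGradient hm hD hf hB (hu0 n).le x)
      (integrableOn_smul_regGradient hm hD hf hB le_rfl x)]
  have hsub := (hgi _ (hu0 n).le).sub (hgi 0 le_rfl)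
  obtain ⟨M, -, hM⟩ := exists_bound_setIntegral_inv_norm_pow (m := m) (j := m - 1) (by omega) hD
  have hi1 : ∀ a, 0 ≤ a → IntegrableOn (fun y => regGradient m a (x - y)) D := fun a ha => by
    simpa using integrableOn_smul_regGradient hm hD (f := fun _ => 1) (B := 1)
      aestronglyMeasurable_const (by simp) ha x
  calc _ ≤ ∫ y in D, B * ‖regGradient m (u n) (x - y) - regGradient m 0 (x - y)‖ := by
        refine norm_integral_le_of_norm_le
          (((hi1 _ (hu0 n).le).sub (hi1 0 le_rfl)).norm.const_mul B)
          (Eventually.of_forall fun y => ?_)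
        rw [← smul_sub, norm_smul]
        gcongr
        exact hB y
    _ = B * ∫ y in D, ‖regGradient m (u n) (x - y) - regGradient m 0 (x - y)‖ :=
        integral_const_mul _ _
    _ ≤ _ := by
        have := setIntegral_comp_sub_le (g := fun z => ‖regGradient m (u n) z - regGradient m 0 z‖)
          (fun z => norm_nonneg _) hDm hR hsub.norm hx
        gcongr

theorem tendsto_integral_regKernel (hm : 3 ≤ m) (hD : Bornology.IsBounded D)
    (hf : AEStronglyMeasurable f (volume.restrict D)) (hB : ∀ x, |f x| ≤ B) {u : ℕ → ℝ}
    (hu0 : ∀ n, 0 < u n) (hu : Tendsto u atTop (𝓝 0)) (x : Euc m) :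
    Tendsto (fun n => ∫ y in D, regKernel m (u n) (x - y) * f y) atTop
      (𝓝 (newtonianPotential D f x)) := by
  have : Nonempty (Fin m) := ⟨⟨0, by omega⟩⟩
  have hne : ∀ᵐ y : Euc m ∂(volume.restrict D), y ∉ ({x} : Set (Euc m)) :=
    measure_eq_zero_iff_ae_notMem.1 (measure_singleton x)
  obtain ⟨M, -, hM⟩ := exists_bound_fundamentalSolution hm hD
  refine tendsto_integral_of_dominated_convergence
    (fun y => |fundamentalSolution m (x - y)| * B) (fun n => ?_) ((hM x).1.abs.mul_const B)
    (fun n => ?_) ?_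
  · exact ((continuous_regKernel (m := m) (hu0 n)).comp
      (continuous_const.sub continuous_id)).aestronglyMeasurable.mul hf
  · filter_upwards [hne] with y hy
    rw [norm_mul]
    gcongr
    · exact abs_regKernel_le hm (hu0 n).le (sub_ne_zero.2 fun h => hy (by simp [h]))
    · exact hB y
  · filter_upwards [hne] with y hy
    rw [← regKernel_zero hm]
    exact (tendsto_regKernel hu (sub_ne_zero.2 fun h => hy (by simp [h]))).mul_const _

/-- The Newtonian potential of a bounded density is differentiable, and the derivative may be
taken under the integral sign. -/
theorem hasFDerivAt_newtonianPotential (hm : 3 ≤ m) (hDm : MeasurableSet D)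
    (hD : Bornology.IsBounded D) (hf : AEStronglyMeasurable f (volume.restrict D))
    (hB : ∀ x, |f x| ≤ B) (x : Euc m) :
    HasFDerivAt (newtonianPotential D f)
      (innerSL ℝ (∫ y in D, f y • regGradient m 0 (x - y))) x := by
  have hu0 : ∀ n : ℕ, 0 < 1 / ((n : ℝ) + 1) := fun n => Nat.one_div_pos_of_nat
  have hu := tendsto_one_div_add_atTop_nhds_zero_nat (𝕜 := ℝ)
  -- Locally uniform convergence of the derivatives and pointwise convergence of the regularized
  -- potentials carry differentiability to the limit.
  have hunif := (innerSL ℝ (E := Euc m)).uniformContinuous.comp_tendstoUniformlyOn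
    (tendstoUniformlyOn_integral_regGradient hm hDm hD hf hB hu0 hu (‖x‖ + 1))
  exact hasFDerivAt_of_tendstoUniformlyOn isOpen_ball hunif
    (fun n x' _ => hasFDerivAt_integral_regKernel hm hD hf hB (hu0 n) x')
    (fun x' _ => tendsto_integral_regKernel hm hD hf hB hu0 hu x') (by simp)

theorem continuous_integral_regGradient_zero (hm : 3 ≤ m) (hDm : MeasurableSet D)
    (hD : Bornology.IsBounded D) (hf : AEStronglyMeasurable f (volume.restrict D))
    (hB : ∀ x, |f x| ≤ B) :
    Continuous (fun x => ∫ y in D, f y • regGradient m 0 (x - y)) := by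
  have hu0 : ∀ n : ℕ, 0 < 1 / ((n : ℝ) + 1) := fun n => Nat.one_div_pos_of_nat
  have hu := tendsto_one_div_add_atTop_nhds_zero_nat (𝕜 := ℝ)
  refine continuous_iff_continuousAt.2 fun x => ?_
  have h := (tendstoUniformlyOn_integral_regGradient hm hDm hD hf hB hu0 hu
    (‖x‖ + 1)).continuousOn (Eventually.of_forall fun n =>
      (continuous_integral_regGradient hm hD hf hB (hu0 n)).continuousOn).frequently
  exact h.continuousAt (isOpen_ball.mem_nhds (by simp))

theorem contDiff_one_newtonianPotential (hm : 3 ≤ m) (hDm : MeasurableSet D)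
    (hD : Bornology.IsBounded D) (hf : AEStronglyMeasurable f (volume.restrict D))
    (hB : ∀ x, |f x| ≤ B) : ContDiff ℝ 1 (newtonianPotential D f) := by
  have h := hasFDerivAt_newtonianPotential hm hDm hD hf hB
  refine contDiff_one_iff_fderiv.2 ⟨fun x => (h x).differentiableAt, ?_⟩
  rw [show fderiv ℝ (newtonianPotential D f) =
    fun x => innerSL ℝ (∫ y in D, f y • regGradient m 0 (x - y)) from
      funext fun x => (h x).fderiv]
  exact (innerSL ℝ).continuous.comp (continuous_integral_regGradient_zero hm hDm hD hf hB)

end FirstDerivatives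

/-! ### Polar coordinates and the identity `∇E * ∇g = g`. -/

section Polar

variable {m : ℕ}

theorem toSphere_real_univ_eq_sphereArea (hm : 1 ≤ m) :
    (volume : Measure (Euc m)).toSphere.real univ = sphereArea m := by
  have : Nonempty (Fin m) := ⟨⟨0, by omega⟩⟩
  have hm0 : (0 : ℝ) < m := by exact_mod_cast hm
  have hΓ := Real.Gamma_pos_of_pos (half_pos hm0)
  rw [Measure.toSphere_real_apply_univ, measureReal_def, EuclideanSpace.volume_ball]
  simp only [ENNReal.ofReal_one, one_pow, one_mul, finrank_euclideanSpace, Fintype.card_fin]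
  rw [ENNReal.toReal_ofReal (by rw [Real.Gamma_add_one (by positivity)]; positivity),
    Real.Gamma_add_one (by positivity), sphereArea, Real.sqrt_eq_rpow, ← Real.rpow_natCast,
    ← Real.rpow_mul Real.pi_pos.le, show 1 / 2 * (m : ℝ) = m / 2 by ring]
  field_simp

/-- Integration in polar coordinates. -/
theorem integral_eq_integral_toSphere {F : Euc m → ℝ} (hm : 1 ≤ m) (hF : Integrable F) :
    ∫ z, F z = ∫ θ : sphere (0 : Euc m) 1,
      (∫ r in Ioi (0 : ℝ), r ^ (m - 1) * F (r • (θ : Euc m))) ∂(volume : Measure (Euc m)).toSphere := by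
  have : Nonempty (Fin m) := ⟨⟨0, by omega⟩⟩
  have hmp := (volume : Measure (Euc m)).measurePreserving_homeomorphUnitSphereProd
  have hemb := (homeomorphUnitSphereProd (Euc m)).measurableEmbedding
  let G : sphere (0 : Euc m) 1 × Ioi (0 : ℝ) → ℝ := fun p => F ((p.2 : ℝ) • (p.1 : Euc m))
  have hG : ∀ x : ({0}ᶜ : Set (Euc m)), G (homeomorphUnitSphereProd (Euc m) x) = F x := by
    intro x
    have h := congr_arg Subtype.val ((homeomorphUnitSphereProd (Euc m)).symm_apply_apply x)
    rw [homeomorphUnitSphereProd_symm_apply_coe] at h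
    simp only [G, h]
  have hGi : Integrable G ((volume : Measure (Euc m)).toSphere.prod
      (.volumeIoiPow (Module.finrank ℝ (Euc m) - 1))) := by
    rw [← hmp.integrable_comp_emb hemb]
    have : G ∘ homeomorphUnitSphereProd (Euc m) = F ∘ Subtype.val := funext hG
    rw [this]
    exact (integrableOn_iff_comap_subtypeVal (measurableSet_singleton _).compl).1 hF.integrableOn
  calc ∫ z, F z = ∫ x : ({0}ᶜ : Set (Euc m)), F x ∂(volume.comap Subtype.val) := by
        rw [integral_subtype_comap (measurableSet_singleton _).compl F, restrict_compl_singleton]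
    _ = ∫ p, G p ∂(volume : Measure (Euc m)).toSphere.prod
          (.volumeIoiPow (Module.finrank ℝ (Euc m) - 1)) := by
        rw [← hmp.integral_comp hemb]
        simp only [hG]
    _ = _ := by
        rw [integral_prod _ hGi]
        congr 1
        ext θ
        simp only [Measure.volumeIoiPow, ENNReal.ofReal, G]
        rw [integral_withDensity_eq_integral_smul
          (measurable_subtype_coe.pow_const _).real_toNNReal,
          integral_subtype_comap measurableSet_Ioi fun r : ℝ =>
            Real.toNNReal (r ^ (Module.finrank ℝ (Euc m) - 1)) • F (r • (θ : Euc m)),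
          setIntegral_congr_fun measurableSet_Ioi fun r hr => ?_]
        simp only [finrank_euclideanSpace, Fintype.card_fin]
        rw [NNReal.smul_def, Real.coe_toNNReal _ (pow_nonneg (le_of_lt hr) _), smul_eq_mul]

theorem integrable_fderiv_regGradient (hm : 3 ≤ m) {g : Euc m → ℝ} (hg : ContDiff ℝ 1 g)
    (hgc : HasCompactSupport g) (x : Euc m) :
    Integrable (fun z => fderiv ℝ g (x - z) (regGradient m 0 z)) := by
  have hcont := hg.continuous_fderiv one_ne_zero
  obtain ⟨C, hC⟩ := (hgc.fderiv ℝ).exists_bound_of_continuous hcont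
  obtain ⟨R, hR⟩ := (hgc.fderiv ℝ).isCompact.isBounded.subset_ball (0 : Euc m)
  have hsupp : Function.support (fun z => fderiv ℝ g (x - z) (regGradient m 0 z)) ⊆
      ball 0 (‖x‖ + R) := by
    intro z hz
    have h1 : x - z ∈ tsupport (fderiv ℝ g) := by
      refine subset_tsupport _ fun h0 => hz ?_
      simp only [h0, zero_apply]
    have h2 := hR h1
    rw [mem_ball_zero_iff] at h2 ⊢
    calc ‖z‖ = ‖x - (x - z)‖ := by rw [sub_sub_cancel]
      _ ≤ ‖x‖ + ‖x - z‖ := norm_sub_le _ _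
      _ < _ := by gcongr
  rw [← integrableOn_iff_integrable_of_support_subset hsupp]
  refine (((integrableOn_ball_inv_norm_pow (m := m) (j := m - 1) (by omega) _).const_mul
    (sphereArea m)⁻¹).const_mul C).mono' ?_ (Eventually.of_forall fun z => ?_)
  · have h1 : Measurable fun z => fderiv ℝ g (x - z) :=
      (hcont.comp (continuous_const.sub continuous_id)).measurable
    exact (ContinuousLinearMap.measurable_apply₂.comp
      (h1.prodMk (measurable_regGradient 0))).aestronglyMeasurable
  · refine (ContinuousLinearMap.le_opNorm _ _).trans ?_
    have hC0 : 0 ≤ C := (norm_nonneg _).trans (hC x)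
    gcongr
    · exact hC _
    · exact norm_regGradient_le hm le_rfl _

/-- `∇E_m * ∇g = g`. -/
theorem integral_fderiv_regGradient (hm : 3 ≤ m) {g : Euc m → ℝ} (hg : ContDiff ℝ 1 g)
    (hgc : HasCompactSupport g) (x : Euc m) :
    ∫ z, fderiv ℝ g (x - z) (regGradient m 0 z) = g x := by
  have hω := sphereArea_pos (m := m) (by omega)
  rw [integral_eq_integral_toSphere (by omega) (integrable_fderiv_regGradient hm hg hgc x)]
  -- The polar weight cancels `|∇E(rθ)| = 1/(ω r^(m-1))`, leaving `-ω⁻¹ d/dr g(x - rθ)`, which the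
  -- fundamental theorem of calculus integrates to `ω⁻¹ g(x)`.
  have hray : ∀ θ : sphere (0 : Euc m) 1, ∫ r in Ioi (0 : ℝ), r ^ (m - 1) *
      fderiv ℝ g (x - r • (θ : Euc m)) (regGradient m 0 (r • (θ : Euc m))) =
      (sphereArea m)⁻¹ * g x := by
    intro θ
    have hθ : ‖(θ : Euc m)‖ = 1 := by simp
    have hθ0 : (θ : Euc m) ≠ 0 := norm_ne_zero_iff.1 (by rw [hθ]; exact one_ne_zero)
    have hd : ∀ r : ℝ, HasDerivAt (fun r : ℝ => g (x - r • (θ : Euc m)))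
        (-(fderiv ℝ g (x - r • (θ : Euc m)) θ)) r := by
      intro r
      have h1 : HasDerivAt (fun r : ℝ => x - r • (θ : Euc m)) (-(θ : Euc m)) r := by
        simpa using ((hasDerivAt_id r).smul_const (θ : Euc m)).const_sub x
      have h2 := ((hg.differentiable one_ne_zero) (x - r • (θ : Euc m))).hasFDerivAt
      have h3 := h2.comp_hasDerivAt r h1
      rw [map_neg] at h3
      exact h3
    have hcs : HasCompactSupport (fun r : ℝ => g (x - r • (θ : Euc m))) := by
      obtain ⟨R, hR⟩ := hgc.isCompact.isBounded.subset_ball (0 : Euc m)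
      refine HasCompactSupport.intro (isCompact_closedBall (0 : ℝ) (‖x‖ + R)) fun r hr => ?_
      by_contra h0
      have h2 := hR (subset_tsupport _ h0)
      rw [mem_ball_zero_iff] at h2
      refine hr ?_
      rw [mem_closedBall_zero_iff]
      calc ‖r‖ = ‖r • (θ : Euc m)‖ := by rw [norm_smul, hθ, mul_one]
        _ = ‖x - (x - r • (θ : Euc m))‖ := by rw [sub_sub_cancel]
        _ ≤ ‖x‖ + ‖x - r • (θ : Euc m)‖ := norm_sub_le _ _
        _ ≤ _ := by gcongr
    have hC1 : ContDiff ℝ 1 (fun r : ℝ => g (x - r • (θ : Euc m))) :=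
      hg.comp (contDiff_const.sub (contDiff_id.smul contDiff_const))
    have hI := hcs.integral_Ioi_deriv_eq hC1 0
    simp only [zero_smul, sub_zero] at hI
    rw [← neg_neg (g x), ← hI, ← integral_neg, ← integral_const_mul]
    refine setIntegral_congr_fun measurableSet_Ioi fun r hr => ?_
    have hr : 0 < r := hr
    simp only [(hd r).deriv, regGradient_zero_eq, norm_smul, hθ, mul_one, map_smul, smul_eq_mul,
      Real.norm_of_nonneg hr.le, neg_neg]
    obtain ⟨k, rfl⟩ : ∃ k, m = k + 1 := ⟨m - 1, by omega⟩
    rw [Nat.add_sub_cancel, pow_succ]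
    field_simp
  simp only [hray]
  rw [integral_const, toSphere_real_univ_eq_sphereArea (by omega), smul_eq_mul]
  field_simp

end Polar

/-! ### Second derivatives: compactly supported densities, harmonicity of `E`. -/

section SecondDerivatives

variable {m : ℕ} {D : Set (Euc m)}

theorem laplacian_eq_sum_fderiv {f : Euc m → ℝ} {x : Euc m} (hf : ContDiffAt ℝ 2 f x)
    {p : Fin m → Euc m → ℝ}
    (hp : ∀ i, ∀ᶠ y in 𝓝 x, fderiv ℝ f y (EuclideanSpace.basisFun (Fin m) ℝ i) = p i y) :
    (Δ f) x = ∑ i, fderiv ℝ (p i) x (EuclideanSpace.basisFun (Fin m) ℝ i) := by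
  rw [InnerProductSpace.laplacian_eq_iteratedFDeriv_orthonormalBasis f
    (EuclideanSpace.basisFun (Fin m) ℝ)]
  refine Finset.sum_congr rfl fun i _ => ?_
  have hd : DifferentiableAt ℝ (fderiv ℝ f) x :=
    (hf.fderiv_right (m := 1) (by norm_num)).differentiableAt one_ne_zero
  have h1 : fderiv ℝ (p i) x =
      fderiv ℝ (fun y => fderiv ℝ f y (EuclideanSpace.basisFun (Fin m) ℝ i)) x :=
    (EventuallyEq.fderiv_eq (hp i)).symm
  rw [iteratedFDeriv_two_apply, h1, fderiv_clm_apply hd (differentiableAt_const _)]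
  simp

theorem locallyIntegrable_fundamentalSolution (hm : 3 ≤ m) :
    LocallyIntegrable (fundamentalSolution m) := by
  intro x
  refine ⟨ball 0 (‖x‖ + 1), isOpen_ball.mem_nhds (by simp), ?_⟩
  have := ((integrableOn_ball_inv_norm_pow (m := m) (j := m - 2) (by omega)
    (‖x‖ + 1)).const_mul (newtonConst m)).neg
  exact IntegrableOn.congr_fun this (fun z _ => (fundamentalSolution_eq m z).symm) measurableSet_ball

theorem fderiv_convolution_right_apply {f g : Euc m → ℝ} (hf : LocallyIntegrable f)
    (hg : ContDiff ℝ 1 g) (hgc : HasCompactSupport g) (x w : Euc m) :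
    fderiv ℝ (f ⋆[ContinuousLinearMap.mul ℝ ℝ, volume] g) x w =
      (f ⋆[ContinuousLinearMap.mul ℝ ℝ, volume] fun y => fderiv ℝ g y w) x := by
  rw [(hgc.hasFDerivAt_convolution_right _ hf hg x).fderiv]
  exact convolution_precompR_apply _ hf (hgc.fderiv ℝ) (hg.continuous_fderiv one_ne_zero) x w

theorem newtonianPotential_eq_convolution {g : Euc m → ℝ} (hg : ∀ x, x ∉ D → g x = 0) :
    newtonianPotential D g =
      fundamentalSolution m ⋆[ContinuousLinearMap.mul ℝ ℝ, volume] g := by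
  ext x
  rw [convolution_eq_swap, newtonianPotential,
    setIntegral_eq_integral_of_forall_compl_eq_zero fun y hy => by rw [hg y hy, mul_zero]]
  rfl

variable {g : Euc m → ℝ}

theorem hasCompactSupport_of_tsupport_subset (hD : Bornology.IsBounded D)
    (hs : tsupport g ⊆ D) : HasCompactSupport g :=
  isCompact_of_isClosed_isBounded (isClosed_tsupport g) (hD.subset hs)

/-- As `g` is supported in `D`, its potential is a convolution over the whole space, and the
derivative can fall on `g`. The second derivatives of the kernel, which are not integrable, never
enter. -/
theorem fderiv_newtonianPotential_apply (hm : 3 ≤ m) (hD : Bornology.IsBounded D)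
    (hg : ContDiff ℝ 1 g) (hs : tsupport g ⊆ D) (x w : Euc m) :
    fderiv ℝ (newtonianPotential D g) x w = newtonianPotential D (fun y => fderiv ℝ g y w) x := by
  have hgc := hasCompactSupport_of_tsupport_subset hD hs
  rw [newtonianPotential_eq_convolution fun x hx => image_eq_zero_of_notMem_tsupport
      fun h => hx (hs h),
    newtonianPotential_eq_convolution (g := fun y => fderiv ℝ g y w) fun x hx => ?_,
    fderiv_convolution_right_apply (locallyIntegrable_fundamentalSolution hm) hg hgc]
  have : x ∉ tsupport (fderiv ℝ g) := fun h => hx (hs (tsupport_fderiv_subset ℝ h))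
  rw [image_eq_zero_of_notMem_tsupport this, zero_apply]

theorem exists_bound_fderiv_apply (hD : Bornology.IsBounded D) (hg : ContDiff ℝ 1 g)
    (hs : tsupport g ⊆ D) (w : Euc m) : ∃ B, ∀ x, |fderiv ℝ g x w| ≤ B := by
  have hgc := hasCompactSupport_of_tsupport_subset hD hs
  obtain ⟨C, hC⟩ := (hgc.fderiv ℝ).exists_bound_of_continuous (hg.continuous_fderiv one_ne_zero)
  refine ⟨C * ‖w‖, fun x => ((fderiv ℝ g x).le_opNorm w).trans ?_⟩
  have := hC x
  gcongr

theorem continuous_fderiv_apply_const (hg : ContDiff ℝ 1 g) (w : Euc m) :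
    Continuous (fun x => fderiv ℝ g x w) :=
  (hg.continuous_fderiv one_ne_zero).clm_apply continuous_const

theorem contDiff_two_newtonianPotential (hm : 3 ≤ m) (hDm : MeasurableSet D)
    (hD : Bornology.IsBounded D) (hg : ContDiff ℝ 1 g) (hs : tsupport g ⊆ D) :
    ContDiff ℝ 2 (newtonianPotential D g) := by
  have hgc := hasCompactSupport_of_tsupport_subset hD hs
  obtain ⟨B, hB⟩ := hgc.exists_bound_of_continuous hg.continuous
  rw [show (2 : WithTop ℕ∞) = 1 + 1 by norm_num, contDiff_succ_iff_fderiv_apply]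
  refine ⟨?_, by simp, fun w => ?_⟩
  · exact (contDiff_one_newtonianPotential hm hDm hD hg.continuous.aestronglyMeasurable
      hB).differentiable one_ne_zero
  · obtain ⟨B', hB'⟩ := exists_bound_fderiv_apply hD hg hs w
    simp_rw [fderiv_newtonianPotential_apply hm hD hg hs]
    exact contDiff_one_newtonianPotential hm hDm hD
      (continuous_fderiv_apply_const hg w).aestronglyMeasurable hB'

/-- The Newtonian potential solves the Poisson equation for continuously differentiable,
compactly supported densities. -/
theorem laplacian_newtonianPotential (hm : 3 ≤ m) (hDm : MeasurableSet D)
    (hD : Bornology.IsBounded D) (hg : ContDiff ℝ 1 g) (hs : tsupport g ⊆ D) (x : Euc m) :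
    (Δ (newtonianPotential D g)) x = g x := by
  have hgc := hasCompactSupport_of_tsupport_subset hD hs
  set e := EuclideanSpace.basisFun (Fin m) ℝ with he
  have hint : ∀ i, IntegrableOn (fun y => fderiv ℝ g y (e i) • regGradient m 0 (x - y)) D := by
    intro i
    obtain ⟨B, hB⟩ := exists_bound_fderiv_apply hD hg hs (e i)
    exact integrableOn_smul_regGradient hm hD
      (continuous_fderiv_apply_const hg (e i)).aestronglyMeasurable hB le_rfl x
  rw [laplacian_eq_sum_fderiv (contDiff_two_newtonianPotential hm hDm hD hg hs).contDiffAt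
    fun i => Eventually.of_forall fun y => fderiv_newtonianPotential_apply hm hD hg hs y _]
  have h1 : ∀ i, fderiv ℝ (newtonianPotential D fun y => fderiv ℝ g y (e i)) x (e i) =
      ∫ y in D, inner ℝ (e i) (regGradient m 0 (x - y)) * fderiv ℝ g y (e i) := by
    intro i
    obtain ⟨B, hB⟩ := exists_bound_fderiv_apply hD hg hs (e i)
    rw [(hasFDerivAt_newtonianPotential hm hDm hD
      (continuous_fderiv_apply_const hg (e i)).aestronglyMeasurable hB x).fderiv,
      innerSL_apply_apply, real_inner_comm, ← integral_inner (hint i)]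
    congr 1
    ext y
    rw [inner_smul_right, mul_comm]
  have h2 : ∀ i, IntegrableOn
      (fun y => inner ℝ (e i) (regGradient m 0 (x - y)) * fderiv ℝ g y (e i)) D := fun i =>
    ((hint i).const_inner (e i)).congr (Eventually.of_forall fun y => by
      simp only [inner_smul_right]; ring)
  have h3 : ∀ y, ∑ i, inner ℝ (e i) (regGradient m 0 (x - y)) * fderiv ℝ g y (e i) =
      fderiv ℝ g y (regGradient m 0 (x - y)) := by
    intro y
    conv_rhs => rw [← e.sum_repr' (regGradient m 0 (x - y))]
    simp
  simp only [← he, h1]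
  rw [← integral_finsetSum _ fun i _ => h2 i]
  simp only [h3]
  -- Extending the integral to the whole space and substituting `z = x - y` gives `∇E * ∇g` at `x`.
  rw [setIntegral_eq_integral_of_forall_compl_eq_zero fun y hy => ?_,
    ← integral_fderiv_regGradient hm hg hgc x,
    ← integral_sub_left_eq_self (fun z => fderiv ℝ g (x - z) (regGradient m 0 z)) volume x]
  · simp only [sub_sub_cancel]
  · have : y ∉ tsupport (fderiv ℝ g) := fun h => hy (hs (tsupport_fderiv_subset ℝ h))
    rw [image_eq_zero_of_notMem_tsupport this, zero_apply]

theorem contDiffAt_fundamentalSolution {n : WithTop ℕ∞} {z : Euc m} (hm : 3 ≤ m) (hz : z ≠ 0) :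
    ContDiffAt ℝ n (fundamentalSolution m) z := by
  have h3 : (3 : ℝ) ≤ m := by exact_mod_cast hm
  have hω := sphereArea_pos (m := m) (by omega)
  refine ContDiffAt.inv (contDiffAt_const.mul ((contDiffAt_norm ℝ hz).pow _)) ?_
  have h1 : (2 : ℝ) - m ≠ 0 := by linarith
  have h2 := norm_ne_zero_iff.2 hz
  positivity

/-- The fundamental solution is harmonic away from the origin. -/
theorem laplacian_fundamentalSolution (hm : 3 ≤ m) {z : Euc m} (hz : z ≠ 0) :
    (Δ (fundamentalSolution m)) z = 0 := by
  set e := EuclideanSpace.basisFun (Fin m) ℝ with he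
  have hz' : 0 < ‖z‖ := norm_pos_iff.2 hz
  have hev : ∀ᶠ y : Euc m in 𝓝 z, y ≠ 0 := isOpen_compl_singleton.mem_nhds hz
  rw [laplacian_eq_sum_fderiv (contDiffAt_fundamentalSolution hm hz)
    (p := fun i y => inner ℝ (regGradient m 0 y) (e i)) fun i => ?_]
  · have hd : ∀ i, fderiv ℝ (fun y => inner ℝ (regGradient m 0 y) (e i)) z (e i) =
        (sphereArea m)⁻¹ * (‖z‖ ^ 2) ^ (-((m : ℝ) / 2)) -
        (sphereArea m)⁻¹ * m * (‖z‖ ^ 2) ^ (-((m : ℝ) / 2) - 1) * inner ℝ z (e i) ^ 2 := by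
      intro i
      have h1 := (((hasFDerivAt_norm_sq_add 0 z).rpow_const (p := -((m : ℝ) / 2))
        (Or.inl (by positivity))).const_mul (sphereArea m)⁻¹).mul
        ((hasFDerivAt_id z).inner ℝ (hasFDerivAt_const (e i) z))
      have h2 : (fun y => inner ℝ (regGradient m 0 y) (e i)) = fun y : Euc m =>
          (sphereArea m)⁻¹ * (‖y‖ ^ 2 + 0) ^ (-((m : ℝ) / 2)) * inner ℝ (id y) (e i) := by
        ext y
        simp [regGradient, inner_smul_left]
      rw [h2, HasFDerivAt.fderiv (f := fun y : Euc m => (sphereArea m)⁻¹ *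
        (‖y‖ ^ 2 + 0) ^ (-((m : ℝ) / 2)) * inner ℝ (id y) (e i)) h1]
      simp
      ring
    change ∑ i, fderiv ℝ (fun y => inner ℝ (regGradient m 0 y) (e i)) z (e i) = 0
    simp only [hd]
    -- Summed over `i`, the first terms give `m ω⁻¹ |z|^(-m)`, and by Parseval the second ones
    -- cancel it.
    have h4 : ∑ i, inner ℝ z (e i) ^ 2 = ‖z‖ ^ 2 := by
      simpa using e.sum_sq_norm_inner_left z
    rw [Finset.sum_sub_distrib, ← Finset.mul_sum, ← Finset.mul_sum, h4,
      Real.rpow_sub_one (by positivity), Finset.sum_const, Finset.card_univ, Fintype.card_fin,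
      nsmul_eq_mul]
    field_simp
    ring
  · filter_upwards [hev] with y hy
    have hy' : 0 < ‖y‖ := norm_pos_iff.2 hy
    rw [← regKernel_zero hm, (hasFDerivAt_regKernel hm (a := 0) (by positivity)).fderiv,
      innerSL_apply_apply]

end SecondDerivatives

/-! ### The Poisson equation for bounded densities that are `C¹` in `D`. -/

section PoissonEquation

variable {m : ℕ} {D : Set (Euc m)} {f : Euc m → ℝ} {B : ℝ}

/-- A smooth, compactly supported kernel which agrees with the fundamental solution on the
shell between two radii. -/
theorem exists_smooth_kernel (hm : 3 ≤ m) {ε ρ : ℝ} (hε : 0 < ε) (hρ : 0 < ρ) :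
    ∃ K : Euc m → ℝ, ContDiff ℝ 3 K ∧ HasCompactSupport K ∧
      ∀ z, ε < ‖z‖ → ‖z‖ < ρ → K =ᶠ[𝓝 z] fundamentalSolution m := by
  -- The factor `1 - b₁` removes the singularity at the origin; `b₂` makes the support compact.
  let b₁ : ContDiffBump (0 : Euc m) := ⟨ε / 2, ε, by positivity, by linarith⟩
  let b₂ : ContDiffBump (0 : Euc m) := ⟨ρ, ρ + 1, hρ, by linarith⟩
  refine ⟨fun z => b₂ z * ((1 - b₁ z) * fundamentalSolution m z), ?_, ?_, fun z h1 h2 => ?_⟩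
  · refine contDiff_iff_contDiffAt.2 fun z => ?_
    by_cases hz : z = 0
    · subst hz
      have h0 : (fun z => b₂ z * ((1 - b₁ z) * fundamentalSolution m z)) =ᶠ[𝓝 0] fun _ => 0 := by
        filter_upwards [b₁.eventuallyEq_one] with z hz
        rw [hz]
        simp
      exact contDiffAt_const.congr_of_eventuallyEq h0
    · exact b₂.contDiff.contDiffAt.mul ((contDiffAt_const.sub b₁.contDiff.contDiffAt).mul
        (contDiffAt_fundamentalSolution hm hz))
  · exact b₂.hasCompactSupport.mul_right
  · have h1' : ∀ᶠ w : Euc m in 𝓝 z, ε < ‖w‖ := continuous_norm.continuousAt.eventually_const_lt h1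
    have h2' : ∀ᶠ w : Euc m in 𝓝 z, ‖w‖ < ρ := continuous_norm.continuousAt.eventually_lt_const h2
    filter_upwards [h1', h2'] with w hw1 hw2
    rw [b₂.one_of_mem_closedBall (by simpa [b₂] using hw2.le),
      b₁.zero_of_le_dist (by simpa [b₁] using hw1.le)]
    ring

/-- The Newtonian potential is harmonic away from the support of its density. -/
theorem newtonianPotential_of_vanishing_near (hm : 3 ≤ m) (hDm : MeasurableSet D)
    (hD : Bornology.IsBounded D) (hf : AEStronglyMeasurable f (volume.restrict D))
    (hB : ∀ x, |f x| ≤ B) {x₀ : Euc m} {ε : ℝ} (hε : 0 < ε)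
    (h0 : ∀ y ∈ ball x₀ (2 * ε), f y = 0) :
    ContDiffAt ℝ 2 (newtonianPotential D f) x₀ ∧ (Δ (newtonianPotential D f)) x₀ = 0 := by
  have : IsFiniteMeasure (volume.restrict D) := ⟨by simpa using hD.measure_lt_top⟩
  obtain ⟨R, hR0, hR⟩ := hD.subset_ball_lt 0 x₀
  -- For `x` within `ε` of `x₀` and `y` in `D` with `f y ≠ 0`, `|x - y|` lies strictly between `ε`
  -- and `ε + R`, so only the shell matters.
  obtain ⟨K, hK, hKc, hKE⟩ := exists_smooth_kernel hm hε (ρ := ε + R) (by positivity)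
  set v : Euc m → ℝ := D.indicator f with hv
  have hvi : LocallyIntegrable v :=
    ((integrable_indicator_iff hDm).2
      (Integrable.of_bound hf B (Eventually.of_forall hB))).locallyIntegrable
  have hshell : ∀ x ∈ ball x₀ ε, ∀ y, v y ≠ 0 → K =ᶠ[𝓝 (x - y)] fundamentalSolution m := by
    intro x hx y hy
    have hyD : y ∈ D := by
      by_contra h
      exact hy (indicator_of_notMem h f)
    have hy1 : y ∉ ball x₀ (2 * ε) := fun h =>
      hy (by rw [hv, indicator_of_mem hyD, h0 y h])
    have hy2 := hR hyD
    rw [mem_ball, dist_eq_norm] at hx hy1 hy2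
    have e1 : y - x₀ = (x - x₀) - (x - y) := by abel
    have e2 : x - y = (x - x₀) - (y - x₀) := by abel
    refine hKE _ ?_ ?_
    · have := norm_sub_le (x - x₀) (x - y)
      rw [← e1] at this
      linarith
    · rw [e2]
      exact (norm_sub_le _ _).trans_lt (add_lt_add hx hy2)
  set N := v ⋆[ContinuousLinearMap.mul ℝ ℝ, volume] K with hN
  have heq : newtonianPotential D f =ᶠ[𝓝 x₀] N := by
    filter_upwards [ball_mem_nhds x₀ hε] with x hx
    rw [hN, convolution_def, newtonianPotential, ← integral_indicator hDm]
    refine integral_congr_ae (Eventually.of_forall fun y => ?_)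
    change _ = v y * K (x - y)
    by_cases hy : v y = 0
    · rw [hy, zero_mul]
      by_cases hyD : y ∈ D
      · rw [hv, indicator_of_mem hyD] at hy
        rw [indicator_of_mem hyD, hy, mul_zero]
      · rw [indicator_of_notMem hyD]
    · have hyD : y ∈ D := by
        by_contra h
        exact hy (indicator_of_notMem h f)
      rw [(hshell x hx y hy).eq_of_nhds, indicator_of_mem hyD, hv, indicator_of_mem hyD, mul_comm]
  have hN2 : ContDiff ℝ 2 N := by
    exact_mod_cast hKc.contDiff_convolution_right (n := 2) (ContinuousLinearMap.mul ℝ ℝ) hvi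
      (hK.of_le (by norm_cast))
  refine ⟨hN2.contDiffAt.congr_of_eventuallyEq heq, ?_⟩
  set e := EuclideanSpace.basisFun (Fin m) ℝ with he
  have hK1 : ∀ i, ContDiff ℝ 2 (fun y => fderiv ℝ K y (e i)) := fun i =>
    (hK.fderiv_right (m := 2) (by norm_num)).clm_apply contDiff_const
  have hK1c : ∀ i, HasCompactSupport (fun y => fderiv ℝ K y (e i)) := fun i => hKc.fderiv_apply ℝ _
  have hK2c : ∀ i, HasCompactSupport
      (fun y => fderiv ℝ (fun y => fderiv ℝ K y (e i)) y (e i)) := fun i => (hK1c i).fderiv_apply ℝ _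
  have hK2 : ∀ i, Continuous (fun y => fderiv ℝ (fun y => fderiv ℝ K y (e i)) y (e i)) := fun i =>
    ((hK1 i).continuous_fderiv two_ne_zero).clm_apply continuous_const
  rw [(InnerProductSpace.laplacian_congr_nhds heq).eq_of_nhds,
    laplacian_eq_sum_fderiv hN2.contDiffAt fun i => Eventually.of_forall fun y =>
      fderiv_convolution_right_apply hvi (hK.of_le (by norm_cast)) hKc y _]
  have hsum : ∀ i, fderiv ℝ (v ⋆[ContinuousLinearMap.mul ℝ ℝ, volume] fun y => fderiv ℝ K y (e i))
      x₀ (e i) = ∫ y, v y * fderiv ℝ (fun y => fderiv ℝ K y (e i)) (x₀ - y) (e i) := fun i =>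
    fderiv_convolution_right_apply hvi ((hK1 i).of_le (by norm_cast)) (hK1c i) x₀ _
  simp only [← he, hsum]
  have hint : ∀ i, Integrable
      (fun y => v y * fderiv ℝ (fun y => fderiv ℝ K y (e i)) (x₀ - y) (e i)) := fun i =>
    (hK2c i).convolutionExists_right (ContinuousLinearMap.mul ℝ ℝ) hvi (hK2 i) x₀
  rw [← integral_finsetSum _ fun i _ => hint i]
  -- The integrand is `v(y) ΔK(x₀ - y)`, and wherever `v` is nonzero `K` agrees locally with the
  -- harmonic function `E`.
  refine integral_eq_zero_of_ae (Eventually.of_forall fun y => ?_)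
  simp only [← Finset.mul_sum, Pi.zero_apply]
  by_cases hy : v y = 0
  · rw [hy, zero_mul]
  · have hE := hshell x₀ (mem_ball_self hε) y hy
    rw [← laplacian_eq_sum_fderiv (f := K) (hK.of_le (by norm_cast)).contDiffAt
      fun i => Eventually.of_forall fun y => rfl,
      (InnerProductSpace.laplacian_congr_nhds hE).eq_of_nhds,
      laplacian_fundamentalSolution hm, mul_zero]
    intro hzero
    have : y ∈ ball x₀ (2 * ε) := by rw [← sub_eq_zero.1 hzero]; exact mem_ball_self (by positivity)
    exact hy (indicator_apply_eq_zero.2 fun _ => h0 y this)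

/-- The Newtonian potential of a bounded density solves the Poisson equation wherever the density
is continuously differentiable. -/
theorem newtonianPotential_poisson (hm : 3 ≤ m) (ho : IsOpen D) (hD : Bornology.IsBounded D)
    (hf : AEStronglyMeasurable f (volume.restrict D)) (hB : ∀ x, |f x| ≤ B)
    (hf1 : ContDiffOn ℝ 1 f D) {x₀ : Euc m} (hx₀ : x₀ ∈ D) :
    ContDiffAt ℝ 2 (newtonianPotential D f) x₀ ∧ (Δ (newtonianPotential D f)) x₀ = f x₀ := by
  obtain ⟨r, hr0, hr⟩ := Metric.isOpen_iff.1 ho x₀ hx₀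
  have hε : 0 < r / 4 := by positivity
  -- Split `f = χf + (1 - χ)f`. The inner radius `2(r/4)` makes the second part vanish on the ball
  -- required by `newtonianPotential_of_vanishing_near`; the outer radius is below `r`, so `χf` is
  -- supported in `D`.
  let χ : ContDiffBump x₀ := ⟨2 * (r / 4), 3 * (r / 4), by positivity, by linarith⟩
  have hχD : tsupport χ ⊆ D := by
    rw [χ.tsupport_eq]
    exact (closedBall_subset_ball (by simp only [χ]; linarith)).trans hr
  have hχf : tsupport (fun x => χ x * f x) ⊆ D := (tsupport_mul_subset_left).trans hχD
  have hg : ContDiff ℝ 1 (fun x => χ x * f x) := by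
    refine contDiff_iff_contDiffAt.2 fun x => ?_
    by_cases hx : x ∈ D
    · exact χ.contDiff.contDiffAt.mul ((hf1 x hx).contDiffAt (ho.mem_nhds hx))
    · have hx' : x ∉ tsupport (fun x => χ x * f x) := fun h => hx (hχf h)
      exact contDiffAt_const.congr_of_eventuallyEq (notMem_tsupport_iff_eventuallyEq.1 hx')
  have hv : AEStronglyMeasurable (fun x => (1 - χ x) * f x) (volume.restrict D) :=
    (continuous_const.sub χ.continuous).aestronglyMeasurable.mul hf
  have hvB : ∀ x, |(1 - χ x) * f x| ≤ B := fun x => by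
    rw [abs_mul, abs_of_nonneg (sub_nonneg.2 χ.le_one)]
    exact (mul_le_of_le_one_left (abs_nonneg _) (by linarith [χ.nonneg (x := x)])).trans (hB x)
  have hgB : ∀ x, |χ x * f x| ≤ B := fun x => by
    rw [abs_mul, abs_of_nonneg χ.nonneg]
    exact (mul_le_of_le_one_left (abs_nonneg _) χ.le_one).trans (hB x)
  have hsplit : newtonianPotential D f =
      newtonianPotential D (fun x => χ x * f x) + newtonianPotential D fun x => (1 - χ x) * f x := by
    ext x
    rw [Pi.add_apply]
    unfold newtonianPotential
    rw [← integral_add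
      (integrableOn_fundamentalSolution_mul hm hD hg.continuous.aestronglyMeasurable hgB x)
      (integrableOn_fundamentalSolution_mul hm hD hv hvB x)]
    congr 1
    ext y
    ring
  have hfar := newtonianPotential_of_vanishing_near hm ho.measurableSet hD hv hvB (x₀ := x₀) hε
    fun y hy => by rw [χ.one_of_mem_closedBall (ball_subset_closedBall hy), sub_self, zero_mul]
  have hnear := (contDiff_two_newtonianPotential hm ho.measurableSet hD hg hχf).contDiffAt (x := x₀)
  rw [hsplit]
  refine ⟨hnear.add hfar.1, ?_⟩
  rw [hnear.laplacian_add hfar.1, hfar.2, add_zero,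
    laplacian_newtonianPotential hm ho.measurableSet hD hg hχf,
    χ.one_of_mem_closedBall (mem_closedBall_self χ.rIn_pos.le), one_mul]

/-- A bounded solution of the integral equation with a harmonic right-hand side is
panharmonic. -/
theorem isPanharmonicOn_of_integral_equation (hm : 3 ≤ m) (ho : IsOpen D)
    (hD : Bornology.IsBounded D) (hf : AEStronglyMeasurable f (volume.restrict D))
    (hB : ∀ x, |f x| ≤ B) {μ : ℝ} {h : Euc m → ℝ} (hh : InnerProductSpace.HarmonicOnNhd h D)
    (heq : ∀ x ∈ D, f x - μ ^ 2 * newtonianPotential D f x = h x) : IsPanharmonicOn μ f D := by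
  have heqOn : EqOn f (h + μ ^ 2 • newtonianPotential D f) D := fun x hx => by
    simp only [Pi.add_apply, Pi.smul_apply, smul_eq_mul, ← heq x hx]
    ring
  -- Bootstrap: `f` is merely bounded, but its potential is `C¹`, so the equation makes `f` itself
  -- `C¹`, as the Poisson equation demands.
  have hf1 : ContDiffOn ℝ 1 f D := by
    refine ContDiffOn.congr ?_ heqOn
    exact (hh.contDiffOn.of_le (by norm_cast)).add
      ((contDiff_one_newtonianPotential hm ho.measurableSet hD hf hB).const_smul (μ ^ 2)).contDiffOn
  have hnhds : ∀ x ∈ D, f =ᶠ[𝓝 x] h + μ ^ 2 • newtonianPotential D f := fun x hx =>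
    heqOn.eventuallyEq_of_mem (ho.mem_nhds hx)
  have hP := fun x (hx : x ∈ D) => newtonianPotential_poisson hm ho hD hf hB hf1 hx
  have hP2 : ∀ x ∈ D, ContDiffAt ℝ 2 (μ ^ 2 • newtonianPotential D f) x := fun x hx =>
    (hP x hx).1.const_smul (μ ^ 2)
  refine ⟨fun x hx => ?_, fun x hx => ?_⟩
  · exact (((hh x hx).1.add (hP2 x hx)).congr_of_eventuallyEq (hnhds x hx)).contDiffWithinAt
  · rw [(InnerProductSpace.laplacian_congr_nhds (hnhds x hx)).eq_of_nhds,
      (hh x hx).1.laplacian_add (hP2 x hx), InnerProductSpace.laplacian_smul _ (hP x hx).1,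
      (hP x hx).2, (hh x hx).2.eq_of_nhds]
    simp

end PoissonEquation

/-! ### Hölder regularity and the main theorem. -/

/-- A solution of the integral equation inherits the Hölder continuity of the right-hand side. -/
theorem isHolderOnClosure_of_integral_equation {m : ℕ} {D : Set (Euc m)} {f h : Euc m → ℝ} {B : ℝ}
    (hm : 3 ≤ m) (hD : Bornology.IsBounded D) (hf : AEStronglyMeasurable f (volume.restrict D))
    (hB : ∀ x, |f x| ≤ B) {c : ℝ} {α : ℝ≥0} (hα : α ≤ 1) (hh : IsHolderOnClosure α h D)
    (heq : ∀ x ∈ closure D, f x - c * newtonianPotential D f x = h x) :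
    IsHolderOnClosure α f D := by
  obtain ⟨C, hC⟩ := hh
  obtain ⟨L, hL0, hL⟩ := exists_lipschitz_bound_newtonianPotential hm hD
  have hB0 : 0 ≤ B := (abs_nonneg _).trans (hB 0)
  have hlip : LipschitzWith (|c| * (L * B)).toNNReal (fun x => c * newtonianPotential D f x) :=
    LipschitzWith.of_dist_le_mul fun x y => by
      rw [Real.coe_toNNReal _ (by positivity), dist_eq_norm, dist_eq_norm, ← mul_sub, norm_mul,
        mul_assoc]
      exact mul_le_mul_of_nonneg_left (hL f B hf hB x y) (abs_nonneg c)
  -- On a bounded set a Lipschitz function is Hölder of every exponent at most 1.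
  obtain ⟨C', hC'⟩ := HolderOnWith.exists_holderOnWith_of_le
    ⟨_, holderOnWith_one.2 (hlip.lipschitzOnWith (s := closure D))⟩ hα hD.closure
  refine ⟨C + C', fun x hx y hy => ?_⟩
  have e : ∀ x ∈ closure D, f x = h x + c * newtonianPotential D f x := fun x hx => by
    rw [← heq x hx]; ring
  rw [e x hx, e y hy, ENNReal.coe_add, add_mul]
  exact (edist_add_add_le _ _ _ _).trans (add_le_add (hC x hx y hy) (hC' x hx y hy))

theorem theorem3p1 (m : ℕ) (hm : 3 ≤ m) (D : Set (Euc m)) (hD : IsBoundedLipschitzDomain D) :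
    ∃ T : L2 D →L[ℝ] L2 D, IsNewtonianOperator D T ∧
      ∀ μ : ℝ, μ ≠ 0 →
        ∃ R : L2 D →L[ℝ] L2 D,
          R * (1 - μ ^ 2 • T) = 1 ∧ (1 - μ ^ 2 • T) * R = 1 ∧
          ∀ α : ℝ≥0, 0 < α → α < 1 →
            ∀ h : Euc m → ℝ, IsHolderOnClosure α h D → InnerProductSpace.HarmonicOnNhd h D →
              ∃ u : Euc m → ℝ,
                IsL2Solution D (μ ^ 2) h u ∧
                (∀ v : Euc m → ℝ, IsL2Solution D (μ ^ 2) h v →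
                  v =ᵐ[volume.restrict D] u) ∧
                (∀ x ∈ D, IntegrableOn (fun y => fundamentalSolution m (x - y) * u y) D ∧
                  u x - μ ^ 2 * newtonianPotential D u x = h x) ∧
                IsHolderOnClosure α u D ∧
                IsPanharmonicOn μ u D ∧
                ∃ hh : MemLp h 2 (volume.restrict D),
                  R (hh.toLp h) =ᵐ[volume.restrict D] u := by
  obtain ⟨T, hT, hneg⟩ := exists_newtonianOperator hm hD.isBounded
  refine ⟨T, hT, fun μ hμ => ?_⟩
  obtain ⟨R, hR₁, hR₂⟩ := isUnit_iff_exists.1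
    (isUnit_one_sub_smul_of_inner_nonpos hneg (sq_nonneg μ))
  refine ⟨R, hR₂, hR₁, fun α hα0 hα1 h hh hharm => ?_⟩
  have hcont : ContinuousOn h (closure D) := by
    obtain ⟨C, hC⟩ := hh
    exact hC.continuousOn hα0
  have hmem := memLp_of_continuousOn_closure hD.isBounded hcont
  -- This `u` solves the equation at every point of the closure; the left inverse `R` shows that it
  -- represents `R h`.
  obtain ⟨u, hum, ⟨B, hB⟩, huc, hueq⟩ := exists_continuousOn_solution hm hD.isOpen hD.isBounded hT
    (pow_ne_zero 2 hμ) hR₂ hcont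
  have hum' : AEStronglyMeasurable u (volume.restrict D) := hum.aestronglyMeasurable
  have hueqD : ∀ x ∈ D, u x - μ ^ 2 * newtonianPotential D u x = h x := fun x hx =>
    hueq x (subset_closure hx)
  have hsol : IsL2Solution D (μ ^ 2) h u := by
    refine ⟨memLp_of_continuousOn_closure hD.isBounded huc, ?_⟩
    filter_upwards [self_mem_ae_restrict hD.isOpen.measurableSet] with x hx using hueqD x hx
  exact ⟨u, hsol,
    fun v hv => (hv.ae_eq hT hR₂ hmem).symm.trans (hsol.ae_eq hT hR₂ hmem),
    fun x hx => ⟨integrableOn_fundamentalSolution_mul hm hD.isBounded hum' hB x, hueqD x hx⟩,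
    isHolderOnClosure_of_integral_equation hm hD.isBounded hum' hB hα1.le hh hueq,
    isPanharmonicOn_of_integral_equation hm hD.isOpen hD.isBounded hum' hB hharm hueqD,
    hmem, hsol.ae_eq hT hR₂ hmem⟩
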